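/- Let $\mathbb F$ be a field and let $\mathcal D=\{D_t\mid t\in T\}$ be a finite collection of finite subsets of $\mathbb F$. A multi-sorted relation over $\mathcal D$ is a set $R\subseteq D_{t_1}\times\dots\times D_{t_k}$ together with its signature $(t_1,\dots,t_k)\in T^k$; a multi-sorted constraint language over $\mathcal D$ is a set of such relations. An instance $\mathcal P=(X,\mathcal D,\delta,\mathcal C)$ of $\mathrm{MCSP}(\Gamma)$ consists of a finite set $X$ of variables, a map $\delta:X\to T$, and a finite collection $\mathcal C$ of constraints $\langle (x_1,\dots,x_k),R\rangle$, where $R\in\Gamma$ has signature $(\delta(x_1),\dots,\delta(x_k))$ (the $x_j$ need not be distinct). Its ideal $I(\mathcal P)\subseteq\mathbb F[X]$ is the sum of the ideal generated by the domain polynomials $\prod_{a\in D_{\delta(x)}}(x-a)$, $x\in X$, and of the ideals of $\mathbb F[X]$ generated, for each constraint $\langle (x_1,\dots,x_k),R\rangle\in\mathcal C$, by $\bigcap_{v\in R}\langle x_1-v_1,\dots,x_k-v_k\rangle\subseteq\mathbb F[x_1,\dots,x_k]$. The problem $\mathrm{IMP}(\Gamma)$ is: given an instance $\mathcal P$ of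 $\mathrm{MCSP}(\Gamma)$ and a polynomial $f\in\mathbb F[X]$, decide whether $f\in I(\mathcal P)$. The problem $\mathrm{IMP}_d(\Gamma)$ is its restriction to inputs with $\deg f\le d$. Inputs are written as words: the sorts of the variables are listed, each constraint is written as the code of its relation followed by its scope, and $f$ is written as a list of terms, each being the code of a coefficient followed by a list of powers $x_i^e$ with $e$ in binary (different terms may contain the same monomial). Here the binary code of relations over $\mathcal D$ is any fixed injective one, and the coefficients are taken from any fixed set $K$ that has an injective binary code and a map $K\to\mathbb F$ (for example $K=\mathbb F$ when $\mathbb F$ is countable, or $K=\mathbb Q$, $\mathbb F=\mathbb C$). The language $\Gamma$ pp-defines the language $\Delta$ over the same $\mathcal D$ if every $R\in\Delta$, of arity $k$ and with signature $\sigma_R$, is given by a formula $$R(x_{m+1},\dots,x_{m+k})=\exists x_1\cdots\exists x_m\, L,$$ where $L$ is a conjunction of atomic formulas over sorted variables $x_1,\dots,x_{m+k}$, each of them either a predicate from $\Gamma$ applied to variables whose sorts form its signature, or an equality between variables of the same sort, where every variable ranges over the domain of its sort, and where the sorts of $x_{m+1},\dots,x_{m+k}$ form $\sigma_R$. **Theorem.**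 Let $\Gamma$ and $\Delta$ be multi-sorted constraint languages over $\mathcal D$, with $\Delta$ finite. If $\Gamma$ pp-defines $\Delta$, then $\mathrm{IMP}(\Delta)$ is polynomial-time many-one reducible to $\mathrm{IMP}(\Gamma)$, and for every $d\ge 0$ the problem $\mathrm{IMP}_d(\Delta)$ is polynomial-time many-one reducible to $\mathrm{IMP}_d(\Gamma)$. -/

import Mathlib

namespace MultiSorted

variable {T F K V : Type}

/-- A multi-sorted relation over the collection `D` of finite domains (subsets of the field `F`):
an arity, a signature, and a set of tuples whose `j`-th entry lies in `D (sig j)`. -/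
structure Relation (D : T → Finset F) where
  arity : ℕ
  sig : Fin arity → T
  tuples : Set (Fin arity → F)
  mem_domain : ∀ v ∈ tuples, ∀ j, v j ∈ D (sig j)

/-- A constraint `⟨s, R⟩` with `R ∈ Γ` on variables `V` whose sorts are given by `δ`; the
signature of `R` has to be the list of sorts of the variables in the scope. Variables may repeat
in the scope. -/
structure Constraint {D : T → Finset F} (Γ : Set (Relation D)) (δ : V → T) where
  rel : Relation D
  rel_mem : rel ∈ Γ
  scope : Fin rel.arity → V
  scope_sort : ∀ j, δ (scope j) = rel.sig j

/-- The assignment `φ` satisfies the constraint. -/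
def Constraint.Holds {D : T → Finset F} {Γ : Set (Relation D)} {δ : V → T}
    (c : Constraint Γ δ) (φ : V → F) : Prop :=
  (fun j => φ (c.scope j)) ∈ c.rel.tuples

/-- Atomic formulas of primitive-positive formulas over `Γ`: predicates from `Γ` and equality
between variables of the same sort. -/
inductive Atom {D : T → Finset F} (Γ : Set (Relation D)) (δ : V → T) where
  | pred (c : Constraint Γ δ)
  | eq (x y : V) (sort_eq : δ x = δ y)

def Atom.Holds {D : T → Finset F} {Γ : Set (Relation D)} {δ : V → T} (φ : V → F) :
    Atom Γ δ → Prop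
  | .pred c => c.Holds φ
  | .eq x y _ => φ x = φ y

/-- A pp-formula `∃ x₁ … xₘ, L` over `Γ` with `k` free variables, `L` a conjunction of atoms. The
bound variables are `Sum.inl i`, the free ones are `Sum.inr j`; `sort` is the signature of `L`. -/
structure PPFormula {D : T → Finset F} (Γ : Set (Relation D)) (k : ℕ) where
  bound : ℕ
  sort : Fin bound ⊕ Fin k → T
  atoms : List (Atom Γ sort)

/-- The tuple `v` satisfies the pp-formula: it extends to an assignment of all variables that
respects the sorts and satisfies all atoms. -/
def PPFormula.Holds {D : T → Finset F} {Γ : Set (Relation D)} {k : ℕ} (L : PPFormula Γ k)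
    (v : Fin k → F) : Prop :=
  ∃ φ : Fin L.bound ⊕ Fin k → F, (∀ x, φ x ∈ D (L.sort x)) ∧ (∀ a ∈ L.atoms, a.Holds φ) ∧
    ∀ j, φ (Sum.inr j) = v j

/-- `Γ` pp-defines `Δ`. -/
def PPDefines {D : T → Finset F} (Γ Δ : Set (Relation D)) : Prop :=
  ∀ R ∈ Δ, ∃ L : PPFormula Γ R.arity,
    (∀ j, L.sort (Sum.inr j) = R.sig j) ∧ ∀ v, v ∈ R.tuples ↔ L.Holds v

/-- An instance of the multi-sorted constraint satisfaction problem over `Γ`, with variables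
`x₀, …, xₙ₋₁` and sorts `δ`. -/
structure MCSP {D : T → Finset F} (Γ : Set (Relation D)) where
  n : ℕ
  δ : Fin n → T
  constraints : List (Constraint Γ δ)

section Ideals

variable [Field F]

/-- The ideal `⟨x_{i₁} - v₁, …, x_{iₖ} - vₖ⟩` of the polynomial ring in the variables of the
scope `s = (x_{i₁}, …, x_{iₖ})`. -/
noncomputable def pointIdeal {k : ℕ} (s : Fin k → V) (v : Fin k → F) :
    Ideal (MvPolynomial (Set.range s) F) :=
  Ideal.span (Set.range fun j : Fin k =>
    (MvPolynomial.X ⟨s j, Set.mem_range_self j⟩ - MvPolynomial.C (v j)))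

/-- The ideal of `F[V]` generated by the ideal of a constraint `⟨s, R⟩`; the latter is the
intersection, over `v ∈ R`, of the ideals of the points `v` in the polynomial ring in the variables
of `s`. -/
noncomputable def Constraint.ideal {D : T → Finset F} {Γ : Set (Relation D)} {δ : V → T}
    (c : Constraint Γ δ) : Ideal (MvPolynomial V F) :=
  Ideal.map (MvPolynomial.rename (R := F) (Subtype.val : Set.range c.scope → V))
    (⨅ v ∈ c.rel.tuples, pointIdeal c.scope v)

/-- The domain polynomial `∏_{a ∈ D_{δ(x)}} (x - a)`. -/
noncomputable def domainPolynomial (D : T → Finset F) (δ : V → T) (x : V) : MvPolynomial V F :=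
  ∏ a ∈ D (δ x), (MvPolynomial.X x - MvPolynomial.C a)

/-- The ideal `I(P)` of an instance: the sum of the ideals of its constraints and of the ideal
generated by the domain polynomials of all variables. -/
noncomputable def MCSP.ideal {D : T → Finset F} {Γ : Set (Relation D)} (P : MCSP Γ) :
    Ideal (MvPolynomial (Fin P.n) F) :=
  (⨆ c ∈ P.constraints, c.ideal) ⊔ Ideal.span (Set.range (domainPolynomial D P.δ))

/-- A polynomial in `n` variables as it is written in an input: a list of terms, each of them a
coefficient `c : K` with a list of powers `x_i ^ e`. -/
abbrev PolyExpr (K : Type) (n : ℕ) : Type := List (K × List (Fin n × ℕ))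

/-- The polynomial over `F` that is written, where the coefficient `c : K` denotes `val c`. -/
noncomputable def PolyExpr.toPoly (val : K → F) {n : ℕ} (p : PolyExpr K n) :
    MvPolynomial (Fin n) F :=
  (p.map fun t => MvPolynomial.C (val t.1) *
    (t.2.map fun q => MvPolynomial.X q.1 ^ q.2).prod).sum

end Ideals

/-- An input `(f, P)` of the ideal membership problem. -/
structure IMPInput {D : T → Finset F} (Γ : Set (Relation D)) (K : Type) where
  inst : MCSP Γ
  poly : PolyExpr K inst.n

/-- The alphabet in which inputs are written. It is finite when `T` is. -/
inductive Sym (T : Type) where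
  | sort (t : T)
  | constraint
  | term
  | var
  | tick
  | bit (b : Bool)

/-- The name of the variable `x_i` (the input has at least one symbol per variable, so unary
numbering is polynomially equivalent to binary). -/
def encodeVar {n : ℕ} (i : Fin n) : List (Sym T) :=
  Sym.var :: List.replicate i.val Sym.tick

/-- A constraint is written as the code of its relation followed by its scope. -/
def Constraint.encode {D : T → Finset F} {Γ : Set (Relation D)} {n : ℕ} {δ : Fin n → T}
    (encR : Computability.Encoding (Relation D) Bool) (c : Constraint Γ δ) : List (Sym T) :=
  Sym.constraint :: ((encR.encode c.rel).map Sym.bit ++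
    (List.ofFn fun j => encodeVar (c.scope j)).flatten)

/-- A term is written as the code of its coefficient followed by its powers `x_i ^ e`, with `e` in
binary. -/
def encodeTerm (encK : Computability.Encoding K Bool) {n : ℕ} (t : K × List (Fin n × ℕ)) :
    List (Sym T) :=
  Sym.term :: ((encK.encode t.1).map Sym.bit ++
    t.2.flatMap fun q => encodeVar q.1 ++ (Computability.encodeNat q.2).map Sym.bit)

/-- An input is written as the list of the sorts of its variables, followed by its constraints and
by the terms of its polynomial. -/
def IMPInput.encode {D : T → Finset F} {Γ : Set (Relation D)}
    (encR : Computability.Encoding (Relation D) Bool) (encK : Computability.Encoding K Bool)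
    (I : IMPInput Γ K) : List (Sym T) :=
  (List.ofFn fun i => Sym.sort (I.inst.δ i)) ++
    (I.inst.constraints.flatMap (Constraint.encode encR) ++ I.poly.flatMap (encodeTerm encK))

/-- A decision problem: instances, written as words over an alphabet, and the set of
yes-instances. -/
structure DecisionProblem where
  Instance : Type
  Alphabet : Type
  encode : Instance → List Alphabet
  Yes : Instance → Prop

/-- Polynomial-time many-one reducibility, with polynomial time on Turing machines. -/
def DecisionProblem.PolyTimeReducible (A B : DecisionProblem) : Prop :=
  ∃ g : A.Instance → B.Instance,
    Nonempty (Turing.TM2ComputableInPolyTime A.encode B.encode g) ∧ ∀ x, A.Yes x ↔ B.Yes (g x)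

/-- The ideal membership problem `IMP(Γ)`: given `(f, P)`, does `f` lie in `I(P)`? -/
def IMP [Field F] {D : T → Finset F} (encR : Computability.Encoding (Relation D) Bool)
    (encK : Computability.Encoding K Bool) (val : K → F) (Γ : Set (Relation D)) :
    DecisionProblem where
  Instance := IMPInput Γ K
  Alphabet := Sym T
  encode := IMPInput.encode encR encK
  Yes I := I.poly.toPoly val ∈ I.inst.ideal

/-- The problem `IMP_d(Γ)`: the inputs of `IMP(Γ)` whose polynomial has degree at most `d`. -/
def IMPd [Field F] {D : T → Finset F} (encR : Computability.Encoding (Relation D) Bool)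
    (encK : Computability.Encoding K Bool) (val : K → F) (d : ℕ) (Γ : Set (Relation D)) :
    DecisionProblem where
  Instance := {I : IMPInput Γ K // (I.poly.toPoly val).totalDegree ≤ d}
  Alphabet := Sym T
  encode I := IMPInput.encode encR encK I.1
  Yes I := I.1.poly.toPoly val ∈ I.1.inst.ideal

end MultiSorted

/-!
The reduction replaces each constraint `⟨s, R⟩` of an instance over `Δ` by the atoms of the
pp-formula that defines `R`, written on a fresh block of variables, one for each variable of the
formula, together with equations that identify the free variables of the block with `s`
(`newPreds`, `newEqs`). The language `Γ` need not express equality, so the equations are solved by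
substitution: each of them is used to replace one variable by another in the remaining equations,
in the predicates and in the polynomial (`merge`). A variable that has been replaced stays in the
list of variables, without constraints, and the degree of the polynomial does not grow
(`IMPInput.totalDegree_reduce_le`).

The ideal of an instance is the ideal of all polynomials that vanish at its solutions
(`MCSP.mem_ideal_iff`). By the combinatorial Nullstellensatz, the domain polynomials generate all
polynomials that vanish on the product of the domains; and for each point of this product that
violates a constraint, the ideal of the constraint contains a polynomial with value `1` there.
Membership is therefore preserved, as the solutions of the new instance restrict, after
substitution, to the solutions of the given one, and all of these arise (`holds_of_new`,
`exists_extension`, `IMPInput.reduce_mem_ideal_iff`).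

For the running time, a small language of structured programs on stacks is compiled to
multi-stack Turing machines, with a bound on the number of steps
(`StackProg.Run.exists_iterate`, `StackProg.nonempty_tm2ComputableInPolyTime`). The program for the
reduction reads the word once and writes the expanded constraints and the equations
(`run_expandAll_constraints`), where the finiteness of `Δ` allows the codes of its relations and
their formulas to be built into the program. Then it solves the equations one by one, each by a
pass through the word that compares the unary indices of variables (`run_substAll`,
`run_mergeAll`). A word of length `l` has at most `l` constraints, so the expansion has `O(l)`
tokens, variables and equations, and the total time is `O(l ^ 3)` (`time_le`, `run_reduceProg`).
-/

/-! ### A structured programming language on stacks -/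

/-- Programs acting on stacks that are indexed by `κ` and have entries in `A`. The program
`loop k cont body` pops the symbol `o` from the stack `k` (`none` if the stack is empty), runs
`body o`, and starts again if and only if `cont o` holds. -/
inductive StackProg (κ A : Type) : Type where
  | skip
  | push (k : κ) (a : A)
  | seq (p q : StackProg κ A)
  | loop (k : κ) (cont : Option A → Bool) (body : Option A → StackProg κ A)

namespace StackProg

open Function (update)
open Turing

variable {κ A : Type}

/-- The labels of the Turing machine that a program is compiled to. -/
def Label : StackProg κ A → Type
  | skip => Unit
  | push _ _ => Unit
  | seq p q => p.Label ⊕ q.Label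
  | loop _ _ body => Option (Σ o, (body o).Label)

/-- The label at which the execution of a program starts. -/
def entry : (p : StackProg κ A) → p.Label
  | skip => ()
  | push _ _ => ()
  | seq p _ => Sum.inl p.entry
  | loop _ _ _ => none

instance finite_label [Finite A] : ∀ p : StackProg κ A, Finite p.Label
  | skip => inferInstanceAs (Finite Unit)
  | push _ _ => inferInstanceAs (Finite Unit)
  | seq p q =>
    have := finite_label p
    have := finite_label q
    inferInstanceAs (Finite (p.Label ⊕ q.Label))
  | loop _ _ body =>
    have := fun o => finite_label (body o)
    inferInstanceAs (Finite (Option (Σ o, (body o).Label)))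

/-- The statements of the compiled program inside a machine with labels `L`: the labels of the
program are placed in the machine by `e`, and the program is left by a jump to `ex`. The internal
state of the machine is the symbol that was popped last. -/
def code {L : Type} : (p : StackProg κ A) → (p.Label → L) → L → p.Label →
    TM2.Stmt (fun _ : κ => A) L (Option A)
  | skip, _, ex, _ => .goto fun _ => ex
  | push k a, _, ex, _ => .push k (fun _ => a) (.goto fun _ => ex)
  | seq p q, e, _, Sum.inl l => p.code (fun l => e (Sum.inl l)) (e (Sum.inr q.entry)) l
  | seq _ q, e, ex, Sum.inr l => q.code (fun l => e (Sum.inr l)) ex l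
  | loop k _ body, e, _, none =>
    .pop k (fun _ o => o) (.goto fun o => e (some ⟨o, (body o).entry⟩))
  | loop _ cont body, e, ex, some ⟨o, l⟩ =>
    (body o).code (fun l => e (some ⟨o, l⟩)) (if cont o then e none else ex) l

variable [DecidableEq κ]

/-- `Run p S S' t`: started on the stacks `S`, the program `p` stops within `t` steps and leaves
the stacks `S'`. -/
inductive Run : StackProg κ A → (κ → List A) → (κ → List A) → ℕ → Prop where
  | skip (S) : Run skip S S 1
  | push (k a S) : Run (push k a) S (update S k (a :: S k)) 1
  | seq {p q S S' S'' t t'} : Run p S S' t → Run q S' S'' t' → Run (seq p q) S S'' (t + t')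
  | last {k cont body S S' t} : cont (S k).head? = false →
      Run (body (S k).head?) (update S k (S k).tail) S' t → Run (loop k cont body) S S' (t + 1)
  | next {k cont body S S' S'' t t'} : cont (S k).head? = true →
      Run (body (S k).head?) (update S k (S k).tail) S' t → Run (loop k cont body) S' S'' t' →
      Run (loop k cont body) S S'' (t + t' + 1)
  | mono {p S S' t t'} : Run p S S' t → t ≤ t' → Run p S S' t'

/-- Runs of a program are runs of every machine that contains the compiled program. -/
theorem Run.exists_iterate {p : StackProg κ A} {S S' : κ → List A} {t : ℕ} (h : Run p S S' t)
    {L : Type} (M : L → TM2.Stmt (fun _ : κ => A) L (Option A)) (e : p.Label → L) (ex : L)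
    (hM : ∀ l, M (e l) = p.code e ex l) (v : Option A) :
    ∃ v', ∃ n ≤ t, (flip bind (TM2.step M))^[n] (some ⟨some (e p.entry), v, S⟩) =
      some ⟨some ex, v', S'⟩ := by
  induction h generalizing ex v with
  | skip S => exact ⟨v, 1, le_rfl, congrArg (fun q => some (TM2.stepAux q v S)) (hM ())⟩
  | push k a S => exact ⟨v, 1, le_rfl, congrArg (fun q => some (TM2.stepAux q v S)) (hM ())⟩
  | @seq p q S S' S'' t t' _ _ ih ih' =>
    obtain ⟨v₁, n₁, h₁, e₁⟩ := ih (fun l => e (Sum.inl l)) (e (Sum.inr q.entry))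
      (fun l => hM (Sum.inl l)) v
    obtain ⟨v₂, n₂, h₂, e₂⟩ := ih' (fun l => e (Sum.inr l)) ex (fun l => hM (Sum.inr l)) v₁
    refine ⟨v₂, n₂ + n₁, by omega, ?_⟩
    rw [Function.iterate_add_apply]
    exact (congrArg _ e₁).trans e₂
  | @last k cont body S S' t hc _ ih =>
    obtain ⟨v₁, n₁, h₁, e₁⟩ := ih (fun l => e (some ⟨_, l⟩)) ex
      (fun l => by simpa [code, hc] using hM (some ⟨_, l⟩)) (S k).head?
    refine ⟨v₁, n₁ + 1, by omega, ?_⟩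
    rw [Function.iterate_add_apply, ← e₁]
    exact congrArg _ (congrArg (fun q => some (TM2.stepAux q v S)) (hM none))
  | @next k cont body S S' S'' t t' hc _ _ ih ih' =>
    obtain ⟨v₁, n₁, h₁, e₁⟩ := ih (fun l => e (some ⟨_, l⟩)) (e none)
      (fun l => by simpa [code, hc] using hM (some ⟨_, l⟩)) (S k).head?
    obtain ⟨v₂, n₂, h₂, e₂⟩ := ih' e ex hM v₁
    refine ⟨v₂, n₂ + n₁ + 1, by omega, ?_⟩
    rw [Function.iterate_add_apply, Function.iterate_add_apply, ← e₂]
    refine congrArg _ (Eq.trans (congrArg _ ?_) e₁)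
    exact congrArg (fun q => some (TM2.stepAux q v S)) (hM none)
  | mono _ hle ih =>
    obtain ⟨v', n, hn, h⟩ := ih e ex hM v
    exact ⟨v', n, hn.trans hle, h⟩

/-- All stacks are empty, except that the stack `k` is `l`. -/
def single (k : κ) (l : List A) : κ → List A := update (fun _ => []) k l

/-- A function that is computed on encodings by a program within polynomial time is computable in
polynomial time by a Turing machine. The stack `k` holds both the input and the output. -/
theorem nonempty_tm2ComputableInPolyTime [Fintype κ] [Finite A] {α β : Type} (ea : α → List A)
    (eb : β → List A) (f : α → β) (p : StackProg κ A) (k : κ) (time : Polynomial ℕ)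
    (hp : ∀ a, Run p (single k (ea a)) (single k (eb (f a))) (time.eval (ea a).length)) :
    Nonempty (TM2ComputableInPolyTime ea eb f) := by
  have := Fintype.ofFinite A
  have := Fintype.ofFinite p.Label
  -- The label `none` is the exit of the program; there the internal state is reset.
  let M : Option p.Label → TM2.Stmt (fun _ : κ => A) (Option p.Label) (Option A) := fun l =>
    l.elim (.load (fun _ => none) .halt) (p.code some none)
  let tm : FinTM2 :=
    { K := κ
      k₀ := k
      k₁ := k
      Γ := fun _ => A
      Λ := Option p.Label
      main := some p.entry
      σ := Option A
      initialState := none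
      Γk₀Fin := inferInstanceAs (Fintype A)
      m := M }
  refine ⟨⟨⟨tm, Equiv.refl A, Equiv.refl A⟩, time + 1, fun a => ?_⟩⟩
  have key := (hp a).exists_iterate M some none (fun _ => rfl) none
  choose v n hn h using key
  refine ⟨⟨n.succ, ?_⟩, by simpa using hn⟩
  have hstk (l : List A) (k' : κ) : single k l k' =
      @dite (List (tm.Γ k')) (k' = tm.k₀) (tm.kDecidableEq k' tm.k₀)
        (fun h => by rw [h]; exact l) fun _ => [] := by
    rcases eq_or_ne k' k with rfl | h
    · simp [tm, single]
    · simp [tm, single, h]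
  have h0 : initList tm (List.map (Equiv.refl A).invFun (ea a)) =
      ⟨some (some p.entry), none, single k (ea a)⟩ := by
    rw [funext (hstk (ea a))]
    simp [initList, tm]
    rfl
  have h1 : haltList tm (List.map (Equiv.refl A).invFun (eb (f a))) =
      ⟨none, none, single k (eb (f a))⟩ := by
    rw [funext (hstk (eb (f a)))]
    simp [haltList, tm]
    rfl
  rw [h0, Option.map_some, h1, Function.iterate_succ_apply']
  refine (congrArg (flip bind (TM2.step M)) h).trans ?_
  rfl

end StackProg

namespace MultiSorted

/-! ### Membership in the ideal of an instance -/

section Ideals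

variable {T F V : Type} {D : T → Finset F} {Γ : Set (Relation D)}

theorem Relation.finite_tuples (R : Relation D) : R.tuples.Finite :=
  (Set.Finite.pi' fun j => (D (R.sig j)).finite_toSet).subset fun v hv j => R.mem_domain v hv j

variable [Field F]

theorem pointIdeal_le_ker_eval {k : ℕ} (s : Fin k → V) (φ : V → F) :
    pointIdeal s (fun j => φ (s j)) ≤
      (RingHom.ker (MvPolynomial.eval φ)).comap
        (MvPolynomial.rename (R := F) (Subtype.val : Set.range s → V)) := by
  rw [pointIdeal, Ideal.span_le]
  rintro _ ⟨j, rfl⟩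
  simp

theorem Constraint.ideal_le_ker_eval {δ : V → T} (c : Constraint Γ δ) {φ : V → F}
    (h : c.Holds φ) : c.ideal ≤ RingHom.ker (MvPolynomial.eval φ) := by
  rw [Constraint.ideal, Ideal.map_le_iff_le_comap]
  exact le_trans (iInf₂_le (fun j => φ (c.scope j)) h) (pointIdeal_le_ker_eval c.scope φ)

/-- A constraint ideal contains, for each assignment that violates the constraint, a polynomial
with value `1` there. -/
theorem Constraint.exists_mem_ideal_eval_eq_one {δ : V → T} (c : Constraint Γ δ) {φ : V → F}
    (h : ¬ c.Holds φ) : ∃ g ∈ c.ideal, MvPolynomial.eval φ g = 1 := by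
  classical
  -- For each tuple `v` of the relation, a linear polynomial vanishes at `v` and is `1` at `φ`.
  have hv : ∀ v ∈ c.rel.tuples, ∃ g ∈ pointIdeal c.scope v,
      MvPolynomial.eval φ (MvPolynomial.rename Subtype.val g) = 1 := by
    intro v hv
    obtain ⟨j, hj⟩ : ∃ j, φ (c.scope j) ≠ v j := by
      by_contra! hc
      exact h (by rwa [Constraint.Holds, funext hc])
    refine ⟨MvPolynomial.C (φ (c.scope j) - v j)⁻¹ *
      (MvPolynomial.X ⟨c.scope j, Set.mem_range_self j⟩ - MvPolynomial.C (v j)), ?_, ?_⟩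
    · rw [pointIdeal]
      exact Ideal.mul_mem_left _ _ (Ideal.subset_span (Set.mem_range_self j))
    · simp [inv_mul_cancel₀ (sub_ne_zero.2 hj)]
  choose! g hg hg1 using hv
  refine ⟨MvPolynomial.rename Subtype.val (∏ v ∈ c.rel.finite_tuples.toFinset, g v),
    Ideal.mem_map_of_mem _ ?_, ?_⟩
  · simp only [Ideal.mem_iInf]
    exact fun v hv => Ideal.mem_of_dvd _
      (Finset.dvd_prod_of_mem g (c.rel.finite_tuples.mem_toFinset.2 hv)) (hg v hv)
  · rw [map_prod, map_prod]
    exact Finset.prod_eq_one fun v hv => hg1 v (c.rel.finite_tuples.mem_toFinset.1 hv)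

/-- A polynomial that vanishes on the product of the domains lies in the ideal generated by the
domain polynomials. -/
theorem mem_span_domainPolynomial [Finite V] (δ : V → T) (f : MvPolynomial V F)
    (hf : ∀ φ : V → F, (∀ x, φ x ∈ D (δ x)) → MvPolynomial.eval φ f = 0) :
    f ∈ Ideal.span (Set.range (domainPolynomial D δ)) := by
  by_cases hne : ∀ x, (D (δ x)).Nonempty
  · obtain ⟨h, -, hh⟩ := MvPolynomial.combinatorial_nullstellensatz_exists_linearCombination
      (fun x => D (δ x)) hne f hf
    rw [hh]
    exact (Finsupp.mem_ideal_span_range_iff_exists_finsupp).2 ⟨h, rfl⟩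
  · -- The domain polynomial of an empty domain is the empty product.
    push Not at hne
    obtain ⟨x, hx⟩ := hne
    have h1 : domainPolynomial D δ x = 1 := by simp [domainPolynomial, hx]
    rw [(Ideal.eq_top_iff_one (Ideal.span (Set.range (domainPolynomial D δ)))).2
      (h1 ▸ Ideal.subset_span (Set.mem_range_self x))]
    trivial

/-- The ideal of an instance consists of the polynomials that vanish at all solutions. -/
theorem MCSP.mem_ideal_iff (P : MCSP Γ) (f : MvPolynomial (Fin P.n) F) :
    f ∈ P.ideal ↔ ∀ φ : Fin P.n → F, (∀ x, φ x ∈ D (P.δ x)) →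
      (∀ c ∈ P.constraints, c.Holds φ) → MvPolynomial.eval φ f = 0 := by
  classical
  constructor
  · intro hf φ hD hC
    have hle : P.ideal ≤ RingHom.ker (MvPolynomial.eval φ) := by
      rw [MCSP.ideal, sup_le_iff, Ideal.span_le]
      refine ⟨iSup₂_le fun c hc => c.ideal_le_ker_eval (hC c hc), ?_⟩
      rintro _ ⟨x, rfl⟩
      simp only [domainPolynomial, SetLike.mem_coe, RingHom.mem_ker, map_prod]
      exact Finset.prod_eq_zero (hD x) (by simp)
    exact hle hf
  · intro hf
    -- For each point of the domain product that is not a solution, the ideal has an element `g`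
    -- with value `1` there. Modulo the ideal, the product of the `1 - g` is `1`.
    have hg : ∀ φ : Fin P.n → F, (¬ ∀ c ∈ P.constraints, c.Holds φ) →
        ∃ g ∈ P.ideal, MvPolynomial.eval φ g = 1 := by
      intro φ hφ
      push Not at hφ
      obtain ⟨c, hc, hφ⟩ := hφ
      obtain ⟨g, hg, h1⟩ := c.exists_mem_ideal_eval_eq_one hφ
      exact ⟨g, Ideal.mem_sup_left (Ideal.mem_iSup_of_mem c (Ideal.mem_iSup_of_mem hc hg)), h1⟩
    choose! g hgI hg1 using hg
    let N := (Fintype.piFinset fun x => D (P.δ x)).filter fun φ =>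
      ¬ ∀ c ∈ P.constraints, c.Holds φ
    have h1 : f * ∏ φ ∈ N, (1 - g φ) ∈ P.ideal := by
      refine Ideal.mem_sup_right (mem_span_domainPolynomial P.δ _ fun φ hD => ?_)
      rw [map_mul, map_prod]
      by_cases hC : ∀ c ∈ P.constraints, c.Holds φ
      · rw [hf φ hD hC, zero_mul]
      · rw [Finset.prod_eq_zero (i := φ) (by simpa [N, hD] using hC) (by simp [hg1 φ hC]), mul_zero]
    rw [← Ideal.Quotient.eq_zero_iff_mem] at h1 ⊢
    rw [map_mul, map_prod, Finset.prod_eq_one, mul_one] at h1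
    · exact h1
    · intro φ hφ
      rw [map_sub, map_one, Ideal.Quotient.eq_zero_iff_mem.2 (hgI φ (Finset.mem_filter.1 hφ).2),
        sub_zero]

end Ideals

end MultiSorted

namespace MultiSorted

/-! ### Constraints on numbered variables -/

section Raw

variable {T F K : Type} {D : T → Finset F} {Γ Δ : Set (Relation D)}

/-- A constraint whose variables are natural numbers, without any condition on their sorts. -/
structure RawConstraint (D : T → Finset F) where
  rel : Relation D
  scope : Fin rel.arity → ℕ

namespace RawConstraint

/-- The assignment `φ` satisfies the constraint. -/
def Holds (c : RawConstraint D) (φ : ℕ → F) : Prop :=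
  (fun j => φ (c.scope j)) ∈ c.rel.tuples

/-- Replace each variable `i` by `ρ i`. -/
def rename (ρ : ℕ → ℕ) (c : RawConstraint D) : RawConstraint D :=
  ⟨c.rel, fun j => ρ (c.scope j)⟩

/-- The constraint is a well-sorted constraint over `Γ` on the variables `0, …, sorts.length - 1`
with the sorts `sorts`. -/
def Valid (Γ : Set (Relation D)) (sorts : List T) (c : RawConstraint D) : Prop :=
  c.rel ∈ Γ ∧ ∀ j, sorts[c.scope j]? = some (c.rel.sig j)

theorem Valid.lt {sorts : List T} {c : RawConstraint D} (h : c.Valid Γ sorts)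
    (j : Fin c.rel.arity) : c.scope j < sorts.length :=
  (List.getElem?_eq_some_iff.1 (h.2 j)).1

theorem Valid.append {sorts : List T} {c : RawConstraint D} (h : c.Valid Γ sorts) (l : List T) :
    c.Valid Γ (sorts ++ l) :=
  ⟨h.1, fun j => by rw [List.getElem?_append_left (h.lt j), h.2 j]⟩

theorem Holds.congr {c : RawConstraint D} {φ ψ : ℕ → F} (h : c.Holds φ)
    (hφ : ∀ j, ψ (c.scope j) = φ (c.scope j)) : c.Holds ψ := by
  rw [Holds, funext hφ]
  exact h

/-- A valid constraint as a constraint on `Fin sorts.length`. -/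
def toConstraint {sorts : List T} (c : RawConstraint D) (h : c.Valid Γ sorts) :
    Constraint Γ sorts.get where
  rel := c.rel
  rel_mem := h.1
  scope j := ⟨c.scope j, h.lt j⟩
  scope_sort j := (List.getElem?_eq_some_iff.1 (h.2 j)).2

end RawConstraint

/-- Forget that the variables of a constraint are well sorted. -/
def Constraint.raw {n : ℕ} {δ : Fin n → T} (c : Constraint Γ δ) : RawConstraint D :=
  ⟨c.rel, fun j => c.scope j⟩

theorem Constraint.raw_valid {n : ℕ} {δ : Fin n → T} (c : Constraint Γ δ) :
    c.raw.Valid Γ (List.ofFn δ) :=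
  ⟨c.rel_mem, fun j => by simpa [raw] using c.scope_sort j⟩

/-- The assignment `φ` respects the sorts. -/
def Respects (D : T → Finset F) (sorts : List T) (φ : ℕ → F) : Prop :=
  ∀ i t, sorts[i]? = some t → φ i ∈ D t

/-! ### Merging variables -/

/-- Substitute `j` for `i`. -/
def subst (i j m : ℕ) : ℕ := if m = i then j else m

/-- Substitute `j` for `i` in both sides of an equation. -/
def substPair (i j : ℕ) (p : ℕ × ℕ) : ℕ × ℕ := (subst i j p.1, subst i j p.2)

/-- The substitution that solves a list of equations between variables: the first equation
`(i, j)` is solved by substituting `j` for `i` everywhere, in particular in the remaining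
equations. -/
def merge : List (ℕ × ℕ) → ℕ → ℕ
  | [], m => m
  | (i, j) :: E, m => merge (E.map (substPair i j)) (subst i j m)
termination_by E => E.length

theorem apply_subst {α : Type} (φ : ℕ → α) {i j : ℕ} (h : φ i = φ j) (m : ℕ) :
    φ (subst i j m) = φ m := by
  unfold subst
  split_ifs with hm
  · rw [hm, h]
  · rfl

/-- A function that satisfies the equations does not change under their solution. -/
theorem apply_merge {α : Type} (φ : ℕ → α) (E : List (ℕ × ℕ)) (h : ∀ p ∈ E, φ p.1 = φ p.2)
    (m : ℕ) : φ (merge E m) = φ m := by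
  induction hn : E.length generalizing E m with
  | zero => rw [List.length_eq_zero_iff.1 hn, merge]
  | succ n ih =>
    obtain ⟨⟨i, j⟩, E, rfl⟩ := List.exists_cons_of_length_eq_add_one hn
    rw [List.forall_mem_cons] at h
    rw [merge, ih _ _ _ (by simpa using hn), apply_subst φ h.1]
    rintro _ hp
    obtain ⟨p, hp', rfl⟩ := List.mem_map.1 hp
    simp only [substPair, apply_subst φ h.1]
    exact h.2 p hp'

theorem merge_eq_merge {E : List (ℕ × ℕ)} {p : ℕ × ℕ} (hp : p ∈ E) :
    merge E p.1 = merge E p.2 := by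
  induction hn : E.length generalizing E p with
  | zero => simp [List.length_eq_zero_iff.1 hn] at hp
  | succ n ih =>
    obtain ⟨⟨i, j⟩, E, rfl⟩ := List.exists_cons_of_length_eq_add_one hn
    rw [merge, merge]
    rcases List.mem_cons.1 hp with rfl | hp
    · simp [subst]
    · exact ih (List.mem_map_of_mem (f := substPair i j) hp) (by simpa using hn)

/-! ### Expanding constraints by pp-formulas -/

namespace PPFormula

variable {k : ℕ} (L : PPFormula Γ k)

/-- The number of variables of a pp-formula. -/
def size : ℕ := L.bound + k

/-- The variables of a pp-formula are numbered, the bound ones first. -/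
def index (x : Fin L.bound ⊕ Fin k) : ℕ := (finSumFinEquiv x : Fin (L.bound + k))

/-- The sorts of the variables of a pp-formula. -/
def sorts : List T := List.ofFn fun i : Fin (L.bound + k) => L.sort (finSumFinEquiv.symm i)

/-- The predicates of a pp-formula, on the block of variables that starts at `cur`. -/
def preds (cur : ℕ) : List (RawConstraint D) :=
  L.atoms.filterMap fun
    | .pred c => some ⟨c.rel, fun j => cur + L.index (c.scope j)⟩
    | .eq _ _ _ => none

/-- The equations of a pp-formula, on the block of variables that starts at `cur`. -/
def eqs (cur : ℕ) : List (ℕ × ℕ) :=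
  L.atoms.filterMap fun
    | .pred _ => none
    | .eq x y _ => some (cur + L.index x, cur + L.index y)

theorem index_lt (x : Fin L.bound ⊕ Fin k) : L.index x < L.size := Fin.is_lt _

@[simp] theorem length_sorts : L.sorts.length = L.size := List.length_ofFn

theorem index_inr (j : Fin k) : L.index (.inr j) = L.bound + j := by simp [index]

theorem sorts_getElem?_index (x : Fin L.bound ⊕ Fin k) :
    L.sorts[L.index x]? = some (L.sort x) := by
  simp [sorts, index]

theorem exists_index_eq {i : ℕ} (h : i < L.size) : ∃ x, L.index x = i :=
  ⟨finSumFinEquiv.symm ⟨i, h⟩, by simp [index]⟩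

theorem index_injective : Function.Injective L.index :=
  Fin.val_injective.comp finSumFinEquiv.injective

theorem mem_preds {cur : ℕ} {c : RawConstraint D} : c ∈ L.preds cur ↔
    ∃ a : Constraint Γ L.sort, .pred a ∈ L.atoms ∧
      c = ⟨a.rel, fun j => cur + L.index (a.scope j)⟩ := by
  simp only [preds, List.mem_filterMap]
  constructor
  · rintro ⟨⟨a⟩ | _, ha, h⟩
    · exact ⟨a, ha, (Option.some.inj h).symm⟩
    · cases h
  · rintro ⟨a, ha, rfl⟩
    exact ⟨_, ha, rfl⟩

theorem mem_eqs {cur : ℕ} {p : ℕ × ℕ} : p ∈ L.eqs cur ↔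
    ∃ x y h, .eq x y h ∈ L.atoms ∧ p = (cur + L.index x, cur + L.index y) := by
  simp only [eqs, List.mem_filterMap]
  constructor
  · rintro ⟨_ | ⟨x, y, h⟩, ha, hp⟩
    · cases hp
    · exact ⟨x, y, h, ha, (Option.some.inj hp).symm⟩
  · rintro ⟨x, y, h, ha, rfl⟩
    exact ⟨_, ha, rfl⟩

/-- The atoms of the formula hold under `x ↦ φ (cur + index x)` if and only if its predicates and
equations hold under `φ` on the block of variables that starts at `cur`. -/
theorem forall_atoms_holds_iff {cur : ℕ} {φ : ℕ → F} :
    (∀ a ∈ L.atoms, a.Holds fun x => φ (cur + L.index x)) ↔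
      (∀ c ∈ L.preds cur, c.Holds φ) ∧ ∀ p ∈ L.eqs cur, φ p.1 = φ p.2 := by
  constructor
  · refine fun h => ⟨fun c hc => ?_, fun p hp => ?_⟩
    · obtain ⟨a, ha, rfl⟩ := L.mem_preds.1 hc
      exact h _ ha
    · obtain ⟨x, y, hs, ha, rfl⟩ := L.mem_eqs.1 hp
      exact h _ ha
  · rintro ⟨hc, he⟩ (a | ⟨x, y, hs⟩) ha
    · exact hc _ (L.mem_preds.2 ⟨a, ha, rfl⟩)
    · exact he _ (L.mem_eqs.2 ⟨x, y, hs, ha, rfl⟩)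

end PPFormula

/-- The equations between the variables `m, m + 1, …` and the entries of a list. -/
def scopeEqs : ℕ → List ℕ → List (ℕ × ℕ)
  | _, [] => []
  | m, x :: l => (m, x) :: scopeEqs (m + 1) l

theorem mem_scopeEqs {m : ℕ} {l : List ℕ} {p : ℕ × ℕ} :
    p ∈ scopeEqs m l ↔ ∃ j, l[j]? = some p.2 ∧ p.1 = m + j := by
  induction l generalizing m with
  | nil => simp [scopeEqs]
  | cons x l ih =>
    simp only [scopeEqs, List.mem_cons, ih]
    constructor
    · rintro (rfl | ⟨j, hj, h⟩)
      · exact ⟨0, rfl, rfl⟩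
      · exact ⟨j + 1, hj, by omega⟩
    · rintro ⟨_ | j, hj, h⟩
      · left
        simp only [List.getElem?_cons_zero, Option.some.injEq] at hj
        ext <;> simp [h, hj]
      · exact Or.inr ⟨j, hj, by omega⟩

theorem mem_scopeEqs_ofFn {m k : ℕ} {s : Fin k → ℕ} {p : ℕ × ℕ} :
    p ∈ scopeEqs m (List.ofFn s) ↔ ∃ j : Fin k, p = (m + j, s j) := by
  rw [mem_scopeEqs]
  constructor
  · rintro ⟨j, hj, h⟩
    obtain ⟨hj, h'⟩ := List.getElem?_eq_some_iff.1 hj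
    rw [List.length_ofFn] at hj
    exact ⟨⟨j, hj⟩, by ext <;> simp [h, ← h']⟩
  · rintro ⟨j, rfl⟩
    exact ⟨j, by simp, rfl⟩

section Expand

variable (L : ∀ R : Relation D, PPFormula Γ R.arity)

/-- The sorts of the fresh variables for a list of constraints: each constraint gets a block of
fresh variables, one for each variable, bound or free, of the formula of its relation. -/
def newSorts (cs : List (RawConstraint D)) : List T := cs.flatMap fun c => (L c.rel).sorts

/-- The predicates on the fresh variables, which start at `cur`. -/
def newPreds : ℕ → List (RawConstraint D) → List (RawConstraint D)
  | _, [] => []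
  | cur, c :: cs => (L c.rel).preds cur ++ newPreds (cur + (L c.rel).size) cs

/-- The equations on the fresh variables, which start at `cur`. The free variables of a block are
equated with the scope of the constraint. -/
def newEqs : ℕ → List (RawConstraint D) → List (ℕ × ℕ)
  | _, [] => []
  | cur, c :: cs => (L c.rel).eqs cur ++ scopeEqs (cur + (L c.rel).bound) (List.ofFn c.scope) ++
      newEqs (cur + (L c.rel).size) cs

variable {L}

theorem newSorts_cons (c : RawConstraint D) (cs : List (RawConstraint D)) :
    newSorts L (c :: cs) = (L c.rel).sorts ++ newSorts L cs := List.flatMap_cons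

theorem getElem?_append_index (l l' : List T) {k : ℕ} (A : PPFormula Γ k)
    (x : Fin A.bound ⊕ Fin k) :
    (l ++ (A.sorts ++ l'))[l.length + A.index x]? = some (A.sort x) := by
  rw [List.getElem?_append_right (by omega), Nat.add_sub_cancel_left,
    List.getElem?_append_left (by rw [A.length_sorts]; exact A.index_lt x), A.sorts_getElem?_index]

theorem valid_of_mem_newPreds (cs : List (RawConstraint D)) (pre : List T) {c : RawConstraint D}
    (hc : c ∈ newPreds L pre.length cs) : c.Valid Γ (pre ++ newSorts L cs) := by
  induction cs generalizing pre with
  | nil => simp [newPreds] at hc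
  | cons d cs ih =>
    rw [newSorts_cons]
    rw [newPreds, List.mem_append] at hc
    rcases hc with hc | hc
    · obtain ⟨a, -, rfl⟩ := (L d.rel).mem_preds.1 hc
      exact ⟨a.rel_mem, fun j => by rw [getElem?_append_index]; exact congrArg _ (a.scope_sort j)⟩
    · rw [← List.append_assoc]
      refine ih _ ?_
      rwa [List.length_append, (L d.rel).length_sorts]

/-- The equations are between variables of the same sort. -/
theorem exists_sort_of_mem_newEqs (hL : ∀ R ∈ Δ, ∀ j, (L R).sort (.inr j) = R.sig j)
    (cs : List (RawConstraint D)) (pre : List T) (hcs : ∀ c ∈ cs, c.Valid Δ pre) {p : ℕ × ℕ}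
    (hp : p ∈ newEqs L pre.length cs) :
    ∃ t, (pre ++ newSorts L cs)[p.1]? = some t ∧ (pre ++ newSorts L cs)[p.2]? = some t := by
  induction cs generalizing pre with
  | nil => simp [newEqs] at hp
  | cons d cs ih =>
    rw [newSorts_cons]
    rw [newEqs, List.mem_append, List.mem_append] at hp
    rw [List.forall_mem_cons] at hcs
    rcases hp with (hp | hp) | hp
    · obtain ⟨x, y, h, -, rfl⟩ := (L d.rel).mem_eqs.1 hp
      exact ⟨_, getElem?_append_index _ _ _ _, by rw [getElem?_append_index, h]⟩
    · obtain ⟨j, rfl⟩ := mem_scopeEqs_ofFn.1 hp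
      refine ⟨_, ?_, (List.getElem?_append_left (hcs.1.lt j)).trans (hcs.1.2 j)⟩
      rw [Nat.add_assoc, ← (L d.rel).index_inr, getElem?_append_index, hL _ hcs.1.1]
    · rw [← List.append_assoc]
      refine ih _ (fun c hc => (hcs.2 c hc).append _) ?_
      rwa [List.length_append, (L d.rel).length_sorts]

variable (hL : ∀ R ∈ Δ, ∀ v, v ∈ R.tuples ↔ (L R).Holds v)
include hL

/-- A solution of the expanded constraints is a solution of the constraints. -/
theorem holds_of_new (cs : List (RawConstraint D)) (pre : List T) (hcs : ∀ c ∈ cs, c.rel ∈ Δ)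
    {φ : ℕ → F} (hφ : Respects D (pre ++ newSorts L cs) φ)
    (hc : ∀ c ∈ newPreds L pre.length cs, c.Holds φ)
    (he : ∀ p ∈ newEqs L pre.length cs, φ p.1 = φ p.2) : ∀ c ∈ cs, c.Holds φ := by
  induction cs generalizing pre with
  | nil => simp
  | cons d cs ih =>
    rw [newSorts_cons] at hφ
    simp only [newPreds, newEqs, List.forall_mem_append, List.forall_mem_cons] at hc he hcs ⊢
    refine ⟨?_, ih (pre ++ (L d.rel).sorts) hcs.2 (by rwa [List.append_assoc]) ?_ ?_⟩
    · rw [RawConstraint.Holds, hL _ hcs.1]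
      refine ⟨fun x => φ (pre.length + (L d.rel).index x),
        fun x => hφ _ _ (getElem?_append_index _ _ _ _),
        (L d.rel).forall_atoms_holds_iff.2 ⟨hc.1, he.1.1⟩, fun j => ?_⟩
      have := he.1.2 _ (mem_scopeEqs_ofFn.2 ⟨j, rfl⟩)
      rwa [Nat.add_assoc, ← (L d.rel).index_inr] at this
    · rw [List.length_append, (L d.rel).length_sorts]
      exact hc.2
    · rw [List.length_append, (L d.rel).length_sorts]
      exact he.2

/-- A solution of the constraints extends to a solution of the expanded constraints. -/
theorem exists_extension (cs : List (RawConstraint D)) (pre : List T)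
    (hcs : ∀ c ∈ cs, c.Valid Δ pre) {φ : ℕ → F} (hφ : Respects D pre φ)
    (hc : ∀ c ∈ cs, c.Holds φ) :
    ∃ ψ : ℕ → F, (∀ i < pre.length, ψ i = φ i) ∧ Respects D (pre ++ newSorts L cs) ψ ∧
      (∀ c ∈ newPreds L pre.length cs, c.Holds ψ) ∧
      ∀ p ∈ newEqs L pre.length cs, ψ p.1 = ψ p.2 := by
  induction cs generalizing pre φ with
  | nil => exact ⟨φ, fun _ _ => rfl, by simpa [newSorts] using hφ, by simp [newPreds],
      by simp [newEqs]⟩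
  | cons d cs ih =>
    rw [List.forall_mem_cons] at hcs hc
    obtain ⟨θ, hθD, hθa, hθ⟩ := (hL _ hcs.1.1 _).1 hc.1
    -- The witnesses for the bound variables of `d` are put on its block.
    obtain ⟨χ, hχ, hχ'⟩ : ∃ χ : ℕ → F, (∀ i < pre.length, χ i = φ i) ∧
        ∀ x, χ (pre.length + (L d.rel).index x) = θ x := by
      classical
      refine ⟨fun i => if h : ∃ x, i = pre.length + (L d.rel).index x then θ h.choose else φ i,
        fun i hi => ?_, fun x => ?_⟩
      · simp only
        rw [dif_neg]
        rintro ⟨x, rfl⟩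
        omega
      · have h : ∃ y, pre.length + (L d.rel).index x = pre.length + (L d.rel).index y := ⟨x, rfl⟩
        simp only
        rw [dif_pos h, ← (L d.rel).index_injective (Nat.add_left_cancel h.choose_spec)]
    have hχD : Respects D (pre ++ (L d.rel).sorts) χ := by
      intro i t hi
      rcases lt_or_ge i pre.length with hlt | hge
      · rw [List.getElem?_append_left hlt] at hi
        rw [hχ i hlt]
        exact hφ i t hi
      · rw [List.getElem?_append_right hge] at hi
        have hlt := (List.getElem?_eq_some_iff.1 hi).1
        rw [(L d.rel).length_sorts] at hlt
        obtain ⟨x, hx⟩ := (L d.rel).exists_index_eq hlt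
        rw [← hx, (L d.rel).sorts_getElem?_index, Option.some.injEq] at hi
        rw [← hi, ← Nat.add_sub_cancel' hge, ← hx, hχ']
        exact hθD x
    obtain ⟨ψ, h1, h2, h3, h4⟩ := ih (pre ++ (L d.rel).sorts)
      (fun c hc => (hcs.2 c hc).append _) hχD
      (fun c hcc => (hc.2 c hcc).congr fun j => hχ _ ((hcs.2 c hcc).lt j))
    rw [List.length_append, (L d.rel).length_sorts] at h1 h3 h4
    have hψ : ∀ i < pre.length, ψ i = φ i := fun i hi => (h1 i (by omega)).trans (hχ i hi)
    have hψ' : (fun x => ψ (pre.length + (L d.rel).index x)) = θ := funext fun x =>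
      (h1 _ (Nat.add_lt_add_left ((L d.rel).index_lt x) _)).trans (hχ' x)
    obtain ⟨h5, h6⟩ := (L d.rel).forall_atoms_holds_iff.1 (by rw [hψ']; exact hθa)
    refine ⟨ψ, hψ, by rwa [newSorts_cons, ← List.append_assoc], ?_, ?_⟩
    · simp only [newPreds, List.forall_mem_append]
      exact ⟨h5, h3⟩
    · simp only [newEqs, List.forall_mem_append]
      refine ⟨⟨h6, fun p hp => ?_⟩, h4⟩
      obtain ⟨j, rfl⟩ := mem_scopeEqs_ofFn.1 hp
      have := congrFun hψ' (.inr j)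
      rw [(L d.rel).index_inr, ← Nat.add_assoc] at this
      rw [this, hψ _ (hcs.1.lt j), hθ]

end Expand

/-! ### The reduction -/

/-- Replace each variable `i` of a written polynomial by `ρ i`. -/
def PolyExpr.rename {n m : ℕ} (ρ : Fin n → Fin m) (p : PolyExpr K n) : PolyExpr K m :=
  p.map fun t => (t.1, t.2.map fun q => (ρ q.1, q.2))

theorem PolyExpr.toPoly_rename [Field F] (val : K → F) {n m : ℕ} (ρ : Fin n → Fin m)
    (p : PolyExpr K n) :
    (p.rename ρ).toPoly val = MvPolynomial.rename ρ (p.toPoly val) := by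
  simp only [PolyExpr.toPoly, PolyExpr.rename, map_list_sum, List.map_map]
  congr 2
  funext t
  simp [map_list_prod, Function.comp_def]

variable (L : ∀ R : Relation D, PPFormula Γ R.arity)

namespace MCSP

variable (P : MCSP Δ)

/-- The constraints of an instance, with their variables as natural numbers. -/
def raws : List (RawConstraint D) := P.constraints.map Constraint.raw

/-- The sorts of the variables of an instance, followed by those of the fresh variables. -/
def allSorts : List T := List.ofFn P.δ ++ newSorts L P.raws

/-- The substitution that solves the equations on the fresh variables of an instance. -/
def merging : ℕ → ℕ := merge (newEqs L P.n P.raws)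

theorem raws_valid : ∀ c ∈ P.raws, c.Valid Δ (List.ofFn P.δ) := by
  intro c hc
  obtain ⟨c, -, rfl⟩ := List.mem_map.1 hc
  exact c.raw_valid

variable {L} {P}

theorem exists_sort_of_mem (hL : ∀ R ∈ Δ, ∀ j, (L R).sort (.inr j) = R.sig j) {p : ℕ × ℕ}
    (hp : p ∈ newEqs L P.n P.raws) :
    ∃ t, (P.allSorts L)[p.1]? = some t ∧ (P.allSorts L)[p.2]? = some t :=
  exists_sort_of_mem_newEqs hL P.raws (List.ofFn P.δ) P.raws_valid (by rwa [List.length_ofFn])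

theorem allSorts_merging (hL : ∀ R ∈ Δ, ∀ j, (L R).sort (.inr j) = R.sig j) (i : ℕ) :
    (P.allSorts L)[P.merging L i]? = (P.allSorts L)[i]? :=
  apply_merge (fun i => (P.allSorts L)[i]?) _ (fun p hp => by
    obtain ⟨t, h1, h2⟩ := exists_sort_of_mem hL hp
    rw [h1, h2]) i

theorem valid_of_mem {c : RawConstraint D} (hc : c ∈ newPreds L P.n P.raws) :
    c.Valid Γ (P.allSorts L) :=
  valid_of_mem_newPreds P.raws (List.ofFn P.δ) (by rwa [List.length_ofFn])

theorem merging_lt (hL : ∀ R ∈ Δ, ∀ j, (L R).sort (.inr j) = R.sig j) {i : ℕ} (hi : i < P.n) :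
    P.merging L i < (P.allSorts L).length := by
  rw [← not_le, ← List.getElem?_eq_none_iff, allSorts_merging hL, List.getElem?_eq_none_iff, not_le,
    allSorts, List.length_append, List.length_ofFn]
  omega

theorem valid_rename_merging (hL : ∀ R ∈ Δ, ∀ j, (L R).sort (.inr j) = R.sig j) :
    ∀ c ∈ (newPreds L P.n P.raws).map (RawConstraint.rename (P.merging L)),
      c.Valid Γ (P.allSorts L) := by
  intro c hc
  obtain ⟨c, hc', rfl⟩ := List.mem_map.1 hc
  obtain ⟨h1, h2⟩ := valid_of_mem hc'
  exact ⟨h1, fun j => (allSorts_merging hL _).trans (h2 j)⟩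

end MCSP

variable {L}

/-- The reduction: each constraint is replaced by the predicates of the formula of its relation on
a block of fresh variables, and the equations between variables that arise are solved by
substitution in the predicates and in the polynomial. Variables that are substituted by others
remain in the list of variables, unconstrained. -/
def IMPInput.reduce (hL : ∀ R ∈ Δ, ∀ j, (L R).sort (.inr j) = R.sig j) (I : IMPInput Δ K) :
    IMPInput Γ K where
  inst :=
    { n := (I.inst.allSorts L).length
      δ := (I.inst.allSorts L).get
      constraints :=
        ((newPreds L I.inst.n I.inst.raws).map (RawConstraint.rename (I.inst.merging L))).pmap
          RawConstraint.toConstraint (MCSP.valid_rename_merging hL) }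
  poly := I.poly.rename fun i => ⟨I.inst.merging L i, MCSP.merging_lt hL i.2⟩

theorem exists_nat_extension {n : ℕ} (φ : Fin n → F) (a : F) :
    ∃ ψ : ℕ → F, ∀ i : Fin n, ψ i = φ i :=
  ⟨fun i => if h : i < n then φ ⟨i, h⟩ else a, fun i => by simp⟩

theorem IMPInput.reduce_mem_ideal_iff [Field F] (val : K → F)
    (hL : ∀ R ∈ Δ, ∀ j, (L R).sort (.inr j) = R.sig j)
    (hL' : ∀ R ∈ Δ, ∀ v, v ∈ R.tuples ↔ (L R).Holds v) (I : IMPInput Δ K) :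
    I.poly.toPoly val ∈ I.inst.ideal ↔
      (I.reduce hL).poly.toPoly val ∈ (I.reduce hL).inst.ideal := by
  rw [MCSP.mem_ideal_iff, MCSP.mem_ideal_iff]
  simp only [IMPInput.reduce, PolyExpr.toPoly_rename]
  have hlen : (List.ofFn I.inst.δ).length = I.inst.n := List.length_ofFn
  constructor
  · intro h φ hφ hc
    obtain ⟨ψ, hψ⟩ := exists_nat_extension φ 0
    have hψD : Respects D (I.inst.allSorts L) (fun i => ψ (I.inst.merging L i)) := by
      intro i t hi
      rw [← MCSP.allSorts_merging hL] at hi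
      obtain ⟨hlt, rfl⟩ := List.getElem?_eq_some_iff.1 hi
      exact Set.mem_of_eq_of_mem (s := (D _ : Set F)) (hψ ⟨_, hlt⟩) (hφ ⟨_, hlt⟩)
    have key := holds_of_new hL' I.inst.raws (List.ofFn I.inst.δ)
      (fun c hc => (I.inst.raws_valid c hc).1) hψD
      (by
        rw [hlen]
        intro c hcn
        have := hc _ (List.mem_pmap.2 ⟨_, List.mem_map_of_mem hcn, rfl⟩)
        simp only [Constraint.Holds, RawConstraint.toConstraint, ← hψ] at this
        exact this)
      (by
        rw [hlen]
        exact fun p hp => congrArg ψ (merge_eq_merge hp))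
    refine (MvPolynomial.eval_rename _ _ _).trans (Eq.trans
      (congrArg (fun θ => MvPolynomial.eval θ _) (funext fun i => (hψ _).symm))
      (h (fun i => ψ (I.inst.merging L i)) (fun i => ?_) fun c hc => ?_))
    · refine hψD i _ ?_
      rw [MCSP.allSorts, List.getElem?_append_left (by simp)]
      simp
    · exact key _ (List.mem_map_of_mem hc)
  · intro h φ hφ hc
    obtain ⟨ψ, hψ⟩ := exists_nat_extension φ 0
    obtain ⟨χ, h1, h2, h3, h4⟩ := exists_extension hL' I.inst.raws (List.ofFn I.inst.δ)
      I.inst.raws_valid (φ := ψ)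
      (by
        intro i t hi
        obtain ⟨hlt, rfl⟩ := List.getElem?_eq_some_iff.1 hi
        rw [List.length_ofFn] at hlt
        rw [hψ ⟨i, hlt⟩, List.getElem_ofFn]
        exact hφ _)
      (by
        intro c hcm
        obtain ⟨c, hcm', rfl⟩ := List.mem_map.1 hcm
        have := hc c hcm'
        simp only [Constraint.Holds, ← hψ] at this
        exact this)
    rw [hlen] at h1 h3 h4
    have hχ : ∀ i, χ (I.inst.merging L i) = χ i := apply_merge χ _ h4
    refine Eq.trans (congrArg (fun θ => MvPolynomial.eval θ _) (funext fun i => ?_))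
      ((MvPolynomial.eval_rename _ _ _).symm.trans (h (fun i => χ i)
        (fun i => h2 i _ (List.getElem?_eq_getElem i.2)) fun c hc => ?_))
    · simp [hχ, h1, hψ]
    · obtain ⟨_, hr, rfl⟩ := List.mem_pmap.1 hc
      obtain ⟨c, hcn, rfl⟩ := List.mem_map.1 hr
      have := h3 c hcn
      simp only [RawConstraint.Holds, ← hχ (c.scope _)] at this
      exact this

theorem IMPInput.totalDegree_reduce_le [Field F] (val : K → F)
    (hL : ∀ R ∈ Δ, ∀ j, (L R).sort (.inr j) = R.sig j) (I : IMPInput Δ K) :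
    ((I.reduce hL).poly.toPoly val).totalDegree ≤ (I.poly.toPoly val).totalDegree := by
  simp only [IMPInput.reduce, PolyExpr.toPoly_rename]
  exact MvPolynomial.totalDegree_rename_le _ _

end Raw

end MultiSorted

/-! ### Basic stack programs -/

namespace StackProg

open Function (update)

variable {κ A : Type}

/-- Pop the entries of `k` and push them on `k'`. -/
def move (k k' : κ) : StackProg κ A :=
  loop k Option.isSome fun o => o.elim skip (push k')

/-- Empty the stack `k`. -/
def clear (k : κ) : StackProg κ A := loop k Option.isSome fun _ => skip

/-- Pop the entries of `k` and push each of them on both `k₁` and `k₂`. -/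
def spread (k k₁ k₂ : κ) : StackProg κ A :=
  loop k Option.isSome fun o => o.elim skip fun a => seq (push k₁ a) (push k₂ a)

/-- Push the entries of a list, the first one first. -/
def pushList (k : κ) : List A → StackProg κ A
  | [] => skip
  | a :: l => seq (push k a) (pushList k l)

/-- Pop one symbol `o` and run `body o`. -/
def popCase (k : κ) (body : Option A → StackProg κ A) : StackProg κ A :=
  loop k (fun _ => false) body

variable [DecidableEq κ]

theorem Run.cast {p : StackProg κ A} {S S₁ S₂ : κ → List A} {t t' : ℕ} (h : Run p S S₁ t)
    (hS : S₁ = S₂) (ht : t ≤ t') : Run p S S₂ t' := hS ▸ h.mono ht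

theorem run_move {k k' : κ} (h : k ≠ k') (S : κ → List A) :
    Run (move k k') S (update (update S k []) k' ((S k).reverse ++ S k'))
      (2 * (S k).length + 2) := by
  induction hl : S k generalizing S with
  | nil =>
    refine (Run.last (by simp [hl]) (by simpa [hl] using Run.skip _)).cast ?_ le_rfl
    funext x
    by_cases hx : x = k' <;> by_cases hx' : x = k <;> simp_all
  | cons a l ih =>
    refine (Run.next (by simp [hl]) (by simpa [hl] using Run.push k' a _)
      (ih _ (by simp [h]))).cast ?_ (by simp; omega)
    funext x
    by_cases hx : x = k' <;> by_cases hx' : x = k <;> simp_all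

theorem run_clear (k : κ) (S : κ → List A) :
    Run (clear k) S (update S k []) (2 * (S k).length + 2) := by
  induction hl : S k generalizing S with
  | nil => exact (Run.last (by simp [hl]) (Run.skip _)).cast (by simp [hl]) le_rfl
  | cons a l ih =>
    exact (Run.next (by simp [hl]) (Run.skip _) (ih _ (by simp [hl]))).cast (by simp)
      (by simp; omega)

theorem run_spread {k k₁ k₂ : κ} (h₁ : k ≠ k₁) (h₂ : k ≠ k₂) (h : k₁ ≠ k₂) (S : κ → List A) :
    Run (spread k k₁ k₂) S (update (update (update S k []) k₁ ((S k).reverse ++ S k₁)) k₂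
      ((S k).reverse ++ S k₂)) (3 * (S k).length + 2) := by
  induction hl : S k generalizing S with
  | nil =>
    refine (Run.last (by simp [hl]) (by simpa [hl] using Run.skip _)).cast ?_ le_rfl
    funext x
    by_cases hx : x = k <;> by_cases hx₁ : x = k₁ <;> by_cases hx₂ : x = k₂ <;> simp_all
  | cons a l ih =>
    refine (Run.next (by simp [hl])
      (by simpa [hl] using Run.seq (Run.push k₁ a _) (Run.push k₂ a _))
      (ih _ (by simp [h₁, h₂]))).cast ?_ (by simp; omega)
    funext x
    by_cases hx : x = k <;> by_cases hx₁ : x = k₁ <;> by_cases hx₂ : x = k₂ <;> simp_all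

theorem run_pushList (k : κ) (l : List A) (S : κ → List A) :
    Run (pushList k l) S (update S k (l.reverse ++ S k)) (l.length + 1) := by
  induction l generalizing S with
  | nil => exact (Run.skip S).cast (by simp) (by simp)
  | cons a l ih => exact (Run.seq (Run.push k a S) (ih _)).cast (by simp) (by simp; omega)

theorem run_popCase {k : κ} {body : Option A → StackProg κ A} {S S' : κ → List A} {t : ℕ}
    (h : Run (body (S k).head?) (update S k (S k).tail) S' t) :
    Run (popCase k body) S S' (t + 1) :=
  Run.last rfl h

end StackProg

namespace MultiSorted

open StackProg
open Function (update)

/-! ### Words of tokens -/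

section Tokens

variable {T : Type}

/-- The tokens of an input word: a variable together with its index is a single token. -/
inductive Tok (T : Type) : Type where
  | sort (t : T)
  | constraint
  | term
  | bit (b : Bool)
  | name (i : ℕ)

namespace Tok

/-- The symbols by which a token is written. -/
def enc : Tok T → List (Sym T)
  | sort t => [Sym.sort t]
  | constraint => [Sym.constraint]
  | term => [Sym.term]
  | bit b => [Sym.bit b]
  | name i => Sym.var :: List.replicate i Sym.tick

/-- Replace the variable `i` by `ρ i`. -/
def map (ρ : ℕ → ℕ) : Tok T → Tok T
  | sort t => sort t
  | constraint => constraint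
  | term => term
  | bit b => bit b
  | name i => name (ρ i)

end Tok

/-- The word that a list of tokens stands for. -/
def encToks (w : List (Tok T)) : List (Sym T) := w.flatMap Tok.enc

@[simp] theorem encToks_nil : encToks ([] : List (Tok T)) = [] := rfl

@[simp] theorem encToks_cons (a : Tok T) (w : List (Tok T)) :
    encToks (a :: w) = a.enc ++ encToks w := List.flatMap_cons

@[simp] theorem encToks_append (w w' : List (Tok T)) :
    encToks (w ++ w') = encToks w ++ encToks w' := List.flatMap_append

theorem Tok.map_comp (ρ ρ' : ℕ → ℕ) (w : List (Tok T)) :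
    (w.map (Tok.map ρ)).map (Tok.map ρ') = w.map (Tok.map fun i => ρ' (ρ i)) := by
  rw [List.map_map]
  exact List.map_congr_left fun a _ => by cases a <;> rfl

/-- All variables in a list of tokens are at most `B`. -/
def NamesLE (B : ℕ) (w : List (Tok T)) : Prop := ∀ i, Tok.name i ∈ w → i ≤ B

theorem NamesLE.append {B : ℕ} {w w' : List (Tok T)} (h : NamesLE B w) (h' : NamesLE B w') :
    NamesLE B (w ++ w') := fun i hi => (List.mem_append.1 hi).elim (h i) (h' i)

theorem NamesLE.map {B : ℕ} {ρ : ℕ → ℕ} {w : List (Tok T)} (h : NamesLE B w)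
    (hρ : ∀ i ≤ B, ρ i ≤ B) : NamesLE B (w.map (Tok.map ρ)) := by
  intro i hi
  obtain ⟨a, ha, h'⟩ := List.mem_map.1 hi
  cases a <;> simp only [Tok.map, Tok.name.injEq, reduceCtorEq] at h'
  subst h'
  exact hρ _ (h _ ha)

theorem NamesLE.length_encToks_le {B : ℕ} {w : List (Tok T)} (h : NamesLE B w) :
    (encToks w).length ≤ w.length * (B + 1) := by
  induction w with
  | nil => simp
  | cons a w ih =>
    have h1 := ih fun i hi => h i (List.mem_cons_of_mem _ hi)
    have h2 : a.enc.length ≤ B + 1 := by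
      cases a with
      | name i => simpa [Tok.enc] using h i List.mem_cons_self
      | _ => simp [Tok.enc]
    rw [encToks_cons, List.length_append, List.length_cons, Nat.add_one_mul]
    omega

theorem length_le_length_encToks (w : List (Tok T)) : w.length ≤ (encToks w).length := by
  induction w with
  | nil => simp
  | cons a w ih =>
    have h2 : 1 ≤ a.enc.length := by cases a <;> simp [Tok.enc]
    rw [encToks_cons, List.length_append, List.length_cons]
    omega

/-- The tokens of an equation between two variables. -/
def pairToks (p : ℕ × ℕ) : List (Tok T) := [Tok.name p.1, Tok.name p.2]

/-- The tokens of a list of equations. -/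
def eqToks (E : List (ℕ × ℕ)) : List (Tok T) := E.flatMap pairToks

theorem length_eqToks (E : List (ℕ × ℕ)) : (eqToks E : List (Tok T)).length = 2 * E.length := by
  induction E with
  | nil => rfl
  | cons p E ih => simp_all [eqToks, pairToks]; omega

end Tokens

/-! ### Solving equations by substitution in a word -/

/-- The stacks of the machine. The stack `main` holds the input, later the word that is being
rewritten, and finally the output; `out` collects rewritten words in reverse; `sorts` and `eqs`
collect the sorts of the variables and the equations, in reverse; the remaining stacks hold numbers
in unary. -/
inductive Reg : Type where
  | main | out | sorts | eqs | i | j | p | q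
  deriving DecidableEq

instance : Fintype Reg :=
  Fintype.ofList [.main, .out, .sorts, .eqs, .i, .j, .p, .q] fun x => by cases x <;> simp

/-- The stacks with the given contents. -/
def regs {A : Type} (main out sorts eqs i j p q : List A) : Reg → List A
  | .main => main
  | .out => out
  | .sorts => sorts
  | .eqs => eqs
  | .i => i
  | .j => j
  | .p => p
  | .q => q

section Regs

variable {A : Type} (a b c d e f g h x : List A)

@[simp] theorem regs_main : regs a b c d e f g h .main = a := rfl
@[simp] theorem regs_out : regs a b c d e f g h .out = b := rfl
@[simp] theorem regs_sorts : regs a b c d e f g h .sorts = c := rfl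
@[simp] theorem regs_eqs : regs a b c d e f g h .eqs = d := rfl
@[simp] theorem regs_i : regs a b c d e f g h .i = e := rfl
@[simp] theorem regs_j : regs a b c d e f g h .j = f := rfl
@[simp] theorem regs_p : regs a b c d e f g h .p = g := rfl
@[simp] theorem regs_q : regs a b c d e f g h .q = h := rfl

@[simp] theorem update_regs_main :
    update (regs a b c d e f g h) .main x = regs x b c d e f g h := by
  funext k; cases k <;> rfl

@[simp] theorem update_regs_out :
    update (regs a b c d e f g h) .out x = regs a x c d e f g h := by
  funext k; cases k <;> rfl

@[simp] theorem update_regs_sorts :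
    update (regs a b c d e f g h) .sorts x = regs a b x d e f g h := by
  funext k; cases k <;> rfl

@[simp] theorem update_regs_eqs :
    update (regs a b c d e f g h) .eqs x = regs a b c x e f g h := by
  funext k; cases k <;> rfl

@[simp] theorem update_regs_i :
    update (regs a b c d e f g h) .i x = regs a b c d x f g h := by
  funext k; cases k <;> rfl

@[simp] theorem update_regs_j :
    update (regs a b c d e f g h) .j x = regs a b c d e x g h := by
  funext k; cases k <;> rfl

@[simp] theorem update_regs_p :
    update (regs a b c d e f g h) .p x = regs a b c d e f x h := by
  funext k; cases k <;> rfl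

@[simp] theorem update_regs_q :
    update (regs a b c d e f g h) .q x = regs a b c d e f g x := by
  funext k; cases k <;> rfl

theorem single_main : single Reg.main a = regs a [] [] [] [] [] [] [] := by
  funext k; cases k <;> rfl

end Regs

section Merging

variable {T : Type}

/-- The unary notation of a number. -/
abbrev ticks (n : ℕ) : List (Sym T) := List.replicate n Sym.tick

/-- Whether the popped symbol is a tick. -/
def isTick : Option (Sym T) → Bool
  | some .tick => true
  | _ => false

/-- Whether the popped symbol starts a variable. -/
def isVar : Option (Sym T) → Bool
  | some .var => true
  | _ => false

@[simp] theorem isTick_head?_encToks (w : List (Tok T)) : isTick (encToks w).head? = false := by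
  rcases w with _ | ⟨_ | _, _⟩ <;> rfl

/-- Pop the ticks on top of `k` and push them on `k'`. -/
def moveTicks (k k' : Reg) : StackProg Reg (Sym T) :=
  loop k isTick fun
    | some .tick => push k' .tick
    | some a => push k a
    | none => skip

theorem run_moveTicks {k k' : Reg} (h : k ≠ k') (n : ℕ) {rest : List (Sym T)}
    (hr : isTick rest.head? = false) (S : Reg → List (Sym T)) (hS : S k = ticks n ++ rest) :
    Run (moveTicks k k') S (update (update S k rest) k' (ticks n ++ S k')) (2 * n + 2) := by
  induction n generalizing S with
  | zero =>
    simp only [ticks, List.replicate_zero, List.nil_append] at hS ⊢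
    refine Run.cast (S₁ := S) (t := 2) (Run.last (by rwa [hS]) ?_) ?_ le_rfl
    · rw [hS]
      rcases rest with _ | ⟨a, rest⟩
      · exact (Run.skip _).cast (by simp [hS]) le_rfl
      · refine Run.cast (S₁ := update (update S k rest) k (a :: rest)) (t := 1) ?_
          (by simp [← hS]) le_rfl
        have := Run.push k a (update S k rest)
        rw [Function.update_self] at this
        cases a <;> first | exact this | cases hr
    · rw [← hS, Function.update_eq_self, Function.update_eq_self]
  | succ n ih =>
    have hk : (S k).head? = some .tick := by rw [hS]; rfl
    refine (Run.next (S' := update (update S k (S k).tail) k' (.tick :: S k')) (t := 1)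
      (by rw [hk]; rfl) ?_ (ih _ ?_)).cast ?_ (by omega)
    · rw [hk]
      exact (Run.push k' _ _).cast (by simp [h.symm]) le_rfl
    · simp [h, hS, ticks, List.replicate_succ]
    · funext x
      by_cases hx : x = k' <;> by_cases hx' : x = k <;>
        simp_all [ticks, List.replicate_succ', List.append_assoc]

/-- Compare the number `m` of ticks on top of `main` with the number `i` on the stack `i`: common
ticks are moved from `i` to `p`, and the excess of `m` is counted on `q`. -/
def compareTicks : StackProg Reg (Sym T) :=
  loop .main isTick fun
    | some .tick => popCase .i fun
        | some a => push .p a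
        | none => push .q .tick
    | some a => push .main a
    | none => skip

theorem run_compareTicks (m i p q : ℕ) {rest : List (Sym T)} (hr : isTick rest.head? = false)
    (o s e j : List (Sym T)) :
    Run compareTicks (regs (ticks m ++ rest) o s e (ticks i) j (ticks p) (ticks q))
      (regs rest o s e (ticks (i - m)) j (ticks (p + min m i)) (ticks (q + (m - i))))
      (3 * m + 2) := by
  induction m generalizing i p q with
  | zero =>
    refine Run.cast (t := 2) (Run.last (by simpa using hr) ?_) rfl le_rfl
    rcases rest with _ | ⟨a, rest⟩
    · exact (Run.skip _).cast (by simp) le_rfl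
    · have := Run.push Reg.main a (regs rest o s e (ticks i) j (ticks p) (ticks q))
      cases a <;> first | (simpa using this) | cases hr
  | succ m ih =>
    rcases i with _ | i
    · refine (Run.next (t := 2) rfl (run_popCase (Run.push _ _ _)) ?_).cast rfl
        (by omega : 2 + (3 * m + 2) + 1 ≤ _)
      have := ih 0 p (q + 1)
      simp only [Nat.zero_sub, Nat.min_zero, Nat.sub_zero, Nat.add_zero] at this ⊢
      change Run compareTicks _ _ _
      simpa [ticks, List.replicate_succ, Nat.add_assoc, Nat.add_comm 1] using this
    · refine (Run.next (t := 2) rfl (run_popCase (Run.push _ _ _)) ?_).cast rfl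
        (by omega : 2 + (3 * m + 2) + 1 ≤ _)
      have := ih i (p + 1) q
      rw [Nat.add_sub_add_right, Nat.add_sub_add_right, Nat.add_min_add_right,
        Nat.add_comm (min m i), ← Nat.add_assoc]
      change Run compareTicks _ _ _
      simpa [ticks, List.replicate_succ] using this

/-- After a comparison, restore the number on the stack `i`, and write the compared number to
`out`, or the number on the stack `j` if the compared numbers are equal. -/
def emitCompared : StackProg Reg (Sym T) :=
  popCase .i fun
    | some a => seq (push .i a) (seq (spread .p .i .out) (move .q .out))
    | none => popCase .q fun
        | some a => seq (push .q a) (seq (spread .p .i .out) (move .q .out))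
        | none => seq (move .p .i) (seq (spread .j .out .q) (move .q .j))

theorem run_restoreCompared (i p q : ℕ) (m o s e j : List (Sym T)) :
    Run (seq (spread .p .i .out) (move .q .out))
      (regs m o s e (ticks i) j (ticks p) (ticks q))
      (regs m (ticks (p + q) ++ o) s e (ticks (p + i)) j [] []) (3 * p + 2 * q + 4) := by
  refine (Run.seq (run_spread (by decide) (by decide) (by decide) _)
    (run_move (by decide) _)).cast ?_ (by simp; omega)
  simp [ticks, ← List.append_assoc, Nat.add_comm q]

/-- Replace the ticks on top of `main`, the index of a variable, by those of its substitute. -/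
theorem run_substTicks {m i j B : ℕ} (hm : m ≤ B) (hi : i ≤ B) (hj : j ≤ B) {rest : List (Sym T)}
    (hr : isTick rest.head? = false) (o s e : List (Sym T)) :
    Run (seq compareTicks emitCompared) (regs (ticks m ++ rest) o s e (ticks i) (ticks j) [] [])
      (regs rest (ticks (subst i j m) ++ o) s e (ticks i) (ticks j) [] []) (10 * B + 14) := by
  refine (Run.seq (run_compareTicks m i 0 0 hr o s e _) (t' := 7 * B + 12) ?_).mono (by omega)
  simp only [Nat.zero_add]
  rcases lt_trichotomy m i with h | rfl | h
  · obtain ⟨d, rfl⟩ := Nat.exists_eq_add_of_lt h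
    have h1 := run_restoreCompared (T := T) (d + 1) m 0 rest o s e (ticks j)
    rw [subst, if_neg h.ne, Nat.min_eq_left h.le, Nat.sub_eq_zero_of_le h.le,
      show m + d + 1 - m = d + 1 by omega]
    refine (run_popCase (Run.seq (t := 1)
      (S'' := regs rest (ticks (m + 0) ++ o) s e (ticks (m + (d + 1))) (ticks j) [] [])
      (Run.push _ _ _) ?_)).cast ?_ (by omega : 1 + (3 * m + 2 * 0 + 4) + 1 ≤ _)
    · simpa [ticks, List.replicate_succ] using h1
    · simp [Nat.add_assoc]
  · rw [subst, if_pos rfl, Nat.min_self, Nat.sub_self]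
    refine (run_popCase (run_popCase (Run.seq (run_move (by decide) _)
      (Run.seq (run_spread (by decide) (by decide) (by decide) _)
        (run_move (by decide) _))))).cast ?_ ?_
    · simp [ticks]
    · simp [ticks]
      omega
  · obtain ⟨d, rfl⟩ := Nat.exists_eq_add_of_lt h
    have h1 := run_restoreCompared (T := T) 0 i (d + 1) rest o s e (ticks j)
    rw [subst, if_neg h.ne', Nat.min_eq_right h.le, Nat.sub_eq_zero_of_le h.le,
      show i + d + 1 - i = d + 1 by omega]
    refine (run_popCase (run_popCase (Run.seq (t := 1)
      (S'' := regs rest (ticks (i + (d + 1)) ++ o) s e (ticks (i + 0)) (ticks j) [] [])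
      (Run.push _ _ _) ?_))).cast ?_ (by omega : 1 + (3 * i + 2 * (d + 1) + 4) + 1 + 1 ≤ _)
    · simpa [ticks, List.replicate_succ] using h1
    · simp [Nat.add_assoc]

/-- Substitute the variable whose index is on the stack `j` for the one whose index is on the stack
`i`, in the whole word on `main`. The result is written to `out`, in reverse. -/
def substAll : StackProg Reg (Sym T) :=
  loop .main Option.isSome fun
    | some .var => seq (push .out .var) (seq compareTicks emitCompared)
    | some a => push .out a
    | none => skip

theorem run_substAll {i j B : ℕ} (hi : i ≤ B) (hj : j ≤ B) (w : List (Tok T)) (hw : NamesLE B w)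
    (o s e : List (Sym T)) :
    Run substAll (regs (encToks w) o s e (ticks i) (ticks j) [] [])
      (regs [] ((encToks (w.map (Tok.map (subst i j)))).reverse ++ o) s e (ticks i) (ticks j) [] [])
      (w.length * (10 * B + 16) + 2) := by
  induction w generalizing o with
  | nil => exact (Run.last rfl (Run.skip _)).cast (by simp) (by simp)
  | cons a w ih =>
    have hw' : NamesLE B w := fun i hi => hw i (List.mem_cons_of_mem _ hi)
    have htime : (10 * B + 15) + (w.length * (10 * B + 16) + 2) + 1 ≤
        (a :: w).length * (10 * B + 16) + 2 := by
      rw [List.length_cons]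
      linarith
    have key (o' : List (Sym T)) (ho : (encToks ((a :: w).map (Tok.map (subst i j)))).reverse ++ o =
        (encToks (w.map (Tok.map (subst i j)))).reverse ++ o') {b : Sym T} {u : List (Sym T)}
        (hb : a.enc = b :: u) (h : Run (match (some b : Option (Sym T)) with
          | some .var => seq (push .out .var) (seq compareTicks emitCompared)
          | some a => push .out a
          | none => skip) (regs (u ++ encToks w) o s e (ticks i) (ticks j) [] [])
          (regs (encToks w) o' s e (ticks i) (ticks j) [] []) (10 * B + 15)) :
        Run substAll (regs (encToks (a :: w)) o s e (ticks i) (ticks j) [] [])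
          (regs [] ((encToks ((a :: w).map (Tok.map (subst i j)))).reverse ++ o) s e (ticks i)
            (ticks j) [] []) ((a :: w).length * (10 * B + 16) + 2) := by
      rw [ho, encToks_cons, hb]
      exact (Run.next rfl (by simpa using h) (ih hw' o')).mono htime
    cases a with
    | name m =>
      refine key (ticks (subst i j m) ++ (.var :: o)) (by simp [Tok.map, Tok.enc]) rfl ?_
      refine (Run.seq (t := 1) (t' := 10 * B + 14) (Run.push _ _ _) ?_).mono (by omega)
      simpa using run_substTicks (hw m List.mem_cons_self) hi hj (isTick_head?_encToks w)
        (.var :: o) s e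
    | _ =>
      refine key _ (by simp [Tok.map, Tok.enc]; rfl) rfl ?_
      exact (Run.push _ _ _).cast (by simp) (by omega)

/-- While a variable is on top of `main`, pop an equation and solve it by substitution in the rest
of the word. -/
def mergeAll : StackProg Reg (Sym T) :=
  loop .main isVar fun
    | some .var => seq (moveTicks .main .i) (seq (popCase .main fun _ => skip)
        (seq (moveTicks .main .j) (seq substAll (seq (move .out .main)
          (seq (clear .i) (clear .j))))))
    | some a => push .main a
    | none => skip

theorem run_mergeAll {B : ℕ} (E : List (ℕ × ℕ)) (w : List (Tok T))
    (hw : ∀ i, w.head? ≠ some (.name i)) (hB : NamesLE B (eqToks E ++ w)) (s : List (Sym T)) :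
    Run mergeAll (regs (encToks (eqToks E ++ w)) [] s [] [] [] [] [])
      (regs (encToks (w.map (Tok.map (merge E)))) [] s [] [] [] [] [])
      (E.length * ((2 * E.length + w.length + 1) * (16 * B + 40)) + 2) := by
  induction hn : E.length generalizing E w with
  | zero =>
    obtain rfl := List.length_eq_zero_iff.1 hn
    have hm : w.map (Tok.map (merge [])) = w := by
      conv_rhs => rw [← List.map_id w]
      refine List.map_congr_left fun a _ => ?_
      cases a <;> simp [Tok.map, merge]
    rw [hm]
    simp only [eqToks, List.flatMap_nil, List.nil_append]
    rcases w with _ | ⟨a, w⟩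
    · exact (Run.last rfl (Run.skip _)).cast (by simp) (by simp)
    · cases a with
      | name i => exact absurd rfl (hw i)
      | _ => exact (Run.last rfl (Run.push _ _ _)).cast (by simp [Tok.enc]) (by simp)
  | succ n ih =>
    obtain ⟨⟨i, j⟩, E, rfl⟩ := List.exists_cons_of_length_eq_add_one hn
    have hn' : E.length = n := by simpa using hn
    have hi : i ≤ B := hB i (by simp [eqToks, pairToks])
    have hj : j ≤ B := hB j (by simp [eqToks, pairToks])
    have hB' : NamesLE B (eqToks E ++ w) := fun i hi => hB i (by
      simp only [eqToks, List.flatMap_cons, List.append_assoc]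
      exact List.mem_append_right _ hi)
    have hmap : (eqToks E ++ w).map (Tok.map (subst i j)) =
        eqToks (E.map (substPair i j)) ++ w.map (Tok.map (subst i j)) := by
      rw [List.map_append, eqToks, eqToks, List.map_flatMap, List.flatMap_map]
      rfl
    have hB'' := hB'.map (ρ := subst i j) (fun m hm => by unfold subst; split_ifs <;> assumption)
    rw [hmap] at hB''
    have hrec := ih (E.map (substPair i j)) (w.map (Tok.map (subst i j)))
      (by
        intro m hm
        rcases w with _ | ⟨a, w⟩
        · simp at hm
        · cases a <;> simp [Tok.map] at hm hw)
      hB'' (by simpa using hn')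
    have hlen := hB''.length_encToks_le
    rw [List.length_append, length_eqToks, List.length_map, List.length_map, hn'] at hlen
    rw [Tok.map_comp, List.length_map] at hrec
    have hfin : w.map (Tok.map (merge ((i, j) :: E))) =
        w.map (Tok.map fun m => merge (E.map (substPair i j)) (subst i j m)) := by
      congr 2
      funext m
      rw [merge]
    rw [hfin]
    have hsub := run_substAll hi hj (eqToks E ++ w) hB' [] s []
    rw [hmap, List.length_append, length_eqToks, hn', List.append_nil] at hsub
    refine (Run.next rfl (S' := regs (encToks (eqToks (E.map (substPair i j)) ++
      w.map (Tok.map (subst i j)))) [] s [] [] [] [] [])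
      (t := (2 * n + w.length + 1) * (16 * B + 40)) ?_ hrec).mono ?_
    · refine (Run.seq (S' := regs (encToks (.name j :: eqToks E ++ w)) [] s [] (ticks i) [] [] [])
        (t := 2 * B + 2) ?_ <| Run.seq (S' := regs (ticks j ++ encToks (eqToks E ++ w)) [] s []
          (ticks i) [] [] []) (t := 2) ?_ <| Run.seq (S' := regs (encToks (eqToks E ++ w)) [] s []
          (ticks i) (ticks j) [] []) (t := 2 * B + 2) ?_ <| Run.seq hsub <| Run.seq
          (run_move (by decide) _) (Run.seq (run_clear _ _) (run_clear _ _))).cast ?_ ?_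
      · refine (run_moveTicks (by decide) i (rest := encToks (.name j :: eqToks E ++ w))
          (isTick_head?_encToks _) _ ?_).cast ?_ (by omega)
        · simp [eqToks, pairToks, Tok.enc]
        · simp
      · exact (run_popCase (Run.skip _)).cast (by simp [Tok.enc]) le_rfl
      · exact (run_moveTicks (by decide) j (isTick_head?_encToks (eqToks E ++ w)) _
          (by simp)).cast (by simp) (by omega)
      · simp
      · simp only [regs_out, List.length_reverse, update_regs_main, update_regs_out, regs_i, regs_j,
          update_regs_i, List.length_replicate]
        nlinarith
    · nlinarith

end Merging

end MultiSorted

namespace MultiSorted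

open StackProg
open Function (update)

/-! ### Writing constraints and polynomials as tokens -/

section Encoding

variable {T F K : Type} {D : T → Finset F} {Γ Δ : Set (Relation D)}
  (encR : Computability.Encoding (Relation D) Bool) (encK : Computability.Encoding K Bool)

/-- The tokens by which a constraint is written. -/
def RawConstraint.toks (c : RawConstraint D) : List (Tok T) :=
  .constraint :: ((encR.encode c.rel).map .bit ++ (List.ofFn c.scope).map .name)

/-- The tokens by which a term of a polynomial is written. -/
def termToks {n : ℕ} (t : K × List (Fin n × ℕ)) : List (Tok T) :=
  .term :: ((encK.encode t.1).map .bit ++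
    t.2.flatMap fun q => .name q.1 :: (Computability.encodeNat q.2).map .bit)

theorem encToks_map_bit (l : List Bool) :
    encToks (l.map (Tok.bit : Bool → Tok T)) = l.map Sym.bit := by
  induction l <;> simp_all [Tok.enc]

theorem encToks_flatMap {α : Type} (f : α → List (Tok T)) (l : List α) :
    encToks (l.flatMap f) = l.flatMap fun a => encToks (f a) :=
  List.flatMap_assoc

theorem RawConstraint.encToks_toks (c : RawConstraint D) :
    encToks (c.toks encR) = Sym.constraint :: ((encR.encode c.rel).map Sym.bit ++
      encToks ((List.ofFn c.scope).map .name)) := by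
  simp [RawConstraint.toks, encToks_map_bit, Tok.enc]

theorem Constraint.encode_eq {n : ℕ} {δ : Fin n → T} (c : Constraint Γ δ) :
    c.encode encR = encToks (c.raw.toks encR) := by
  rw [RawConstraint.encToks_toks, Constraint.encode, encToks, List.flatMap_def, List.map_map,
    List.map_ofFn]
  rfl

theorem encodeTerm_eq {n : ℕ} (t : K × List (Fin n × ℕ)) :
    (encodeTerm encK t : List (Sym T)) = encToks (termToks encK t) := by
  simp only [encodeTerm, termToks, encToks_cons, encToks_append, encToks_map_bit, encToks_flatMap]
  rfl

theorem IMPInput.encode_eq (I : IMPInput Γ K) :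
    I.encode encR encK = (List.ofFn I.inst.δ).map Sym.sort ++
      (encToks (I.inst.raws.flatMap (RawConstraint.toks encR)) ++
        encToks (I.poly.flatMap (termToks encK))) := by
  have h : ∀ l : List (Constraint Γ I.inst.δ), l.flatMap (Constraint.encode encR) =
      encToks ((l.map Constraint.raw).flatMap (RawConstraint.toks encR)) := fun l => by
    rw [encToks_flatMap, List.flatMap_map]
    exact List.flatMap_congr fun c _ => c.encode_eq encR
  rw [IMPInput.encode, h, encToks_flatMap (termToks encK), List.map_ofFn,
    List.flatMap_congr fun t _ => encodeTerm_eq (T := T) encK t]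
  rfl

theorem RawConstraint.toks_rename (ρ : ℕ → ℕ) (c : RawConstraint D) :
    (c.rename ρ).toks encR = (c.toks encR).map (Tok.map ρ) := by
  simp only [toks, rename, List.map_cons, List.map_append, List.map_map, List.map_ofFn]
  rfl

theorem flatMap_toks_map_rename (ρ : ℕ → ℕ) (l : List (RawConstraint D)) :
    (l.map (RawConstraint.rename ρ)).flatMap (RawConstraint.toks encR) =
      (l.flatMap (RawConstraint.toks encR)).map (Tok.map ρ) := by
  rw [List.map_flatMap, List.flatMap_map]
  exact List.flatMap_congr fun c _ => c.toks_rename encR ρ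

theorem flatMap_termToks_rename {n m : ℕ} (ρ : ℕ → ℕ) (ρ' : Fin n → Fin m)
    (h : ∀ i, (ρ' i : ℕ) = ρ i) (p : PolyExpr K n) :
    ((p.rename ρ').flatMap (termToks encK) : List (Tok T)) =
      (p.flatMap (termToks encK)).map (Tok.map ρ) := by
  rw [List.map_flatMap, PolyExpr.rename, List.flatMap_map]
  refine List.flatMap_congr fun t _ => ?_
  simp only [termToks, List.map_cons, List.map_append, List.map_map, List.map_flatMap,
    List.flatMap_map, h]
  rfl

theorem map_raw_pmap_toConstraint {sorts : List T} (l : List (RawConstraint D))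
    (h : ∀ c ∈ l, c.Valid Γ sorts) :
    (l.pmap RawConstraint.toConstraint h).map Constraint.raw = l := by
  induction l with
  | nil => rfl
  | cons c l ih => exact congrArg (c :: ·) (ih _)

/-- The word to which the input of the reduction is mapped. -/
theorem IMPInput.encode_reduce {L : ∀ R : Relation D, PPFormula Γ R.arity}
    (hL : ∀ R ∈ Δ, ∀ j, (L R).sort (.inr j) = R.sig j) (I : IMPInput Δ K) :
    (I.reduce hL).encode encR encK = (I.inst.allSorts L).map Sym.sort ++
      encToks (((newPreds L I.inst.n I.inst.raws).flatMap (RawConstraint.toks encR) ++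
        I.poly.flatMap (termToks encK)).map (Tok.map (I.inst.merging L))) := by
  rw [IMPInput.encode_eq, List.map_append, encToks_append, ← flatMap_toks_map_rename]
  congr 2
  · simp [IMPInput.reduce]
  · exact congrArg (fun l => encToks (l.flatMap (RawConstraint.toks encR)))
      (map_raw_pmap_toConstraint _ _)
  · exact congrArg encToks (flatMap_termToks_rename encK (I.inst.merging L)
      (fun i => ⟨I.inst.merging L i, MCSP.merging_lt hL i.2⟩) (fun _ => rfl) I.poly)

end Encoding

/-! ### Expanding the constraints of a word -/

section Expansion

variable {T : Type}

/-- Append the number on the stack `j` to the stack `k`; the stack `i` is used for copying. -/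
def copyCounter (k : Reg) : StackProg Reg (Sym T) := seq (spread .j .i k) (move .i .j)

/-- Write a token in reverse; the index of a variable is relative to the number on the stack
`j`. -/
def emitTok (k : Reg) : Tok T → StackProg Reg (Sym T)
  | .name m => seq (push k .var) (seq (copyCounter k) (pushList k (ticks m)))
  | a => pushList k a.enc

/-- Write a list of tokens in reverse; the indices of variables are relative to the number on the
stack `j`. -/
def emitToks (k : Reg) : List (Tok T) → StackProg Reg (Sym T)
  | [] => skip
  | a :: w => seq (emitTok k a) (emitToks k w)

theorem run_copyCounter {k : Reg} (hki : k ≠ .i) (hkj : k ≠ .j) {n : ℕ} (S : Reg → List (Sym T))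
    (hi : S .i = []) (hj : S .j = ticks n) :
    Run (copyCounter k) S (update S k (ticks n ++ S k)) (5 * n + 4) := by
  refine (Run.seq (run_spread (by decide) hkj.symm hki.symm S) (run_move (by decide) _)).cast ?_ ?_
  · funext x
    by_cases hx : x = k <;> by_cases hxi : x = .i <;> by_cases hxj : x = .j <;>
      simp_all [ticks, Ne.symm]
  · simp [hki.symm, hi, hj]
    omega

theorem exists_run_emitTok {k : Reg} (hki : k ≠ .i) (hkj : k ≠ .j) (a : Tok T) :
    ∃ c, ∀ n (S : Reg → List (Sym T)), S .i = [] → S .j = ticks n →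
      Run (emitTok k a) S (update S k ((a.map (n + ·)).enc.reverse ++ S k)) (c * (n + 1)) := by
  cases a with
  | name m =>
    refine ⟨m + 7, fun n S hi hj => ?_⟩
    refine (Run.seq (Run.push _ _ _) (Run.seq (run_copyCounter hki hkj _
      (by simpa [hki.symm] using hi) (by simpa [hkj.symm] using hj))
      (run_pushList _ _ _))).cast ?_ ?_
    · simp only [Tok.map, Tok.enc, Nat.add_comm n, Function.update_self, Function.update_idem,
        List.reverse_replicate, List.reverse_cons, ← List.append_assoc,
        List.replicate_append_replicate]
      simp
    · simp
      nlinarith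
  | _ =>
    exact ⟨2, fun n S _ _ => (run_pushList _ _ _).cast rfl (by simp [Tok.enc])⟩

theorem exists_run_emitToks {k : Reg} (hki : k ≠ .i) (hkj : k ≠ .j) (w : List (Tok T)) :
    ∃ c, ∀ n (S : Reg → List (Sym T)), S .i = [] → S .j = ticks n →
      Run (emitToks k w) S (update S k ((encToks (w.map (Tok.map (n + ·)))).reverse ++ S k))
        (c * (n + 1)) := by
  induction w with
  | nil => exact ⟨1, fun n S _ _ => (Run.skip S).cast (by simp) (by omega)⟩
  | cons a w ih =>
    obtain ⟨c, hc⟩ := exists_run_emitTok hki hkj a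
    obtain ⟨c', hc'⟩ := ih
    refine ⟨c + c', fun n S hi hj => ?_⟩
    exact (Run.seq (hc n S hi hj) (hc' n _ (by simpa [hki.symm] using hi)
      (by simpa [hkj.symm] using hj))).cast (by simp) (by rw [Nat.add_mul])

/-- Move `k` variables from `main` to `eqs`, each of them preceded by a variable with relative
index `m`, `m + 1`, …. -/
def emitScope : ℕ → ℕ → StackProg Reg (Sym T)
  | _, 0 => skip
  | m, k + 1 => seq (emitTok .eqs (.name m)) (seq (popCase .main fun _ => push .eqs .var)
      (seq (moveTicks .main .eqs) (emitScope (m + 1) k)))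

theorem exists_run_emitScope (m k : ℕ) :
    ∃ c, ∀ (B n : ℕ) (l : List ℕ) (rest o s e : List (Sym T)), l.length = k → (∀ i ∈ l, i ≤ B) →
      n ≤ B → isTick rest.head? = false →
      Run (emitScope m k) (regs (encToks (l.map .name) ++ rest) o s e [] (ticks n) [] [])
        (regs rest o s ((encToks (eqToks (scopeEqs (n + m) l))).reverse ++ e) [] (ticks n) [] [])
        (c * (B + 1)) := by
  induction k generalizing m with
  | zero =>
    refine ⟨1, fun B n l rest o s e hl _ _ _ => ?_⟩
    obtain rfl := List.length_eq_zero_iff.1 hl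
    exact (Run.skip _).cast (by simp [scopeEqs, eqToks]) (by omega)
  | succ k ih =>
    obtain ⟨c, hc⟩ := exists_run_emitTok (k := Reg.eqs) (by decide) (by decide) (Tok.name m : Tok T)
    obtain ⟨c', hc'⟩ := ih (m + 1)
    refine ⟨c + c' + 4, fun B n l rest o s e hl hB hn hr => ?_⟩
    obtain ⟨x, l, rfl⟩ := List.exists_cons_of_length_eq_add_one hl
    have hx : x ≤ B := hB x List.mem_cons_self
    have hr' : isTick (encToks (l.map (Tok.name : ℕ → Tok T)) ++ rest).head? = false := by
      rcases l with _ | ⟨y, l⟩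
      · simpa using hr
      · rfl
    have h1 := hc n (regs (encToks ((x :: l).map .name) ++ rest) o s e [] (ticks n) [] []) rfl rfl
    rw [update_regs_eqs, regs_eqs] at h1
    have h2 := hc' B n l rest o s
      (ticks x ++ Sym.var :: ((encToks [Tok.name (n + m)]).reverse ++ e))
      (by simpa using hl) (fun i hi => hB i (List.mem_cons_of_mem _ hi)) hn hr
    refine (Run.seq h1 (Run.seq (S' := regs (ticks x ++ (encToks (l.map .name) ++ rest)) o s
      (Sym.var :: ((encToks [Tok.name (n + m)]).reverse ++ e)) [] (ticks n) [] []) (t := 2) ?_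
      (Run.seq (t := 2 * x + 2) ?_ h2))).cast ?_ ?_
    · refine (run_popCase (Run.push _ _ _)).cast ?_ le_rfl
      simp [Tok.enc, Tok.map]
    · exact (run_moveTicks (by decide) x hr' _ rfl).cast (by simp) le_rfl
    · simp [scopeEqs, eqToks, pairToks, Tok.enc, Nat.add_assoc]
    · nlinarith

/-- Whether the popped symbol is a bit. -/
def isBit : Option (Sym T) → Bool
  | some (.bit _) => true
  | _ => false

/-- Pop a word of at most `d` bits from `main`, and run `body` for this word, preceded by `w`. -/
def readBits (body : List Bool → StackProg Reg (Sym T)) : ℕ → List Bool → StackProg Reg (Sym T)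
  | 0, w => body w
  | d + 1, w => popCase .main fun
      | some (.bit b) => readBits body d (w ++ [b])
      | some a => seq (push .main a) (body w)
      | none => body w

theorem run_readBits {body : List Bool → StackProg Reg (Sym T)} {d : ℕ} {bits w : List Bool}
    (hd : bits.length ≤ d) {rest : List (Sym T)} (hr : isBit rest.head? = false)
    {o s e i j p q : List (Sym T)} {S' : Reg → List (Sym T)} {t : ℕ}
    (h : Run (body (w ++ bits)) (regs rest o s e i j p q) S' t) :
    Run (readBits body d w) (regs (bits.map .bit ++ rest) o s e i j p q) S'
      (t + bits.length + 2) := by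
  induction d generalizing bits w with
  | zero =>
    obtain rfl := List.length_eq_zero_iff.1 (Nat.le_zero.1 hd)
    simp only [List.append_nil] at h
    exact h.mono (by omega)
  | succ d ih =>
    rcases bits with _ | ⟨b, bits⟩
    · simp only [List.append_nil, List.map_nil, List.nil_append] at h ⊢
      rcases rest with _ | ⟨a, rest⟩
      · exact (run_popCase (by simpa using h)).mono (by simp)
      · have h' : Run (seq (push .main a) (body w)) (regs rest o s e i j p q) S' (1 + t) :=
          Run.seq (Run.push _ _ _) (by simpa using h)
        refine (run_popCase (t := 1 + t) ?_).mono (by simp; omega)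
        cases a <;> first | (simpa using h') | cases hr
    · refine (run_popCase (t := t + bits.length + 2) ?_).mono
        (by rw [List.length_cons]; omega)
      have := ih (bits := bits) (w := w ++ [b]) (by simpa using hd) (by simpa using h)
      simpa using this

variable {F : Type} {D : T → Finset F} {Γ Δ : Set (Relation D)}
  (encR : Computability.Encoding (Relation D) Bool)

section

variable {k : ℕ} (A : PPFormula Γ k)

/-- Expand a constraint by the pp-formula of its relation: write the predicates and the equations
of the formula on a fresh block of variables, equate the free variables of the formula with the
scope, which is popped from `main`, and append the sorts of the block. The number of variables is
on the stack `j`. -/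
def expandConstraint : StackProg Reg (Sym T) :=
  seq (emitToks .out ((A.preds 0).flatMap (RawConstraint.toks encR)))
    (seq (emitToks .eqs (eqToks (A.eqs 0)))
      (seq (emitScope A.bound k)
        (seq (pushList .sorts (A.sorts.map .sort)) (pushList .j (ticks A.size)))))

theorem PPFormula.preds_eq_map (n : ℕ) :
    A.preds n = (A.preds 0).map (RawConstraint.rename (n + ·)) := by
  simp only [PPFormula.preds, List.map_filterMap]
  congr 1
  funext a
  cases a <;> simp [RawConstraint.rename]

theorem PPFormula.eqs_eq_map (n : ℕ) :
    A.eqs n = (A.eqs 0).map fun p => (n + p.1, n + p.2) := by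
  simp only [PPFormula.eqs, List.map_filterMap]
  congr 1
  funext a
  cases a <;> simp

theorem eqToks_map (ρ : ℕ → ℕ) (E : List (ℕ × ℕ)) :
    (eqToks (E.map fun p => (ρ p.1, ρ p.2)) : List (Tok T)) = (eqToks E).map (Tok.map ρ) := by
  simp only [eqToks, List.map_flatMap, List.flatMap_map]
  rfl

theorem eqToks_append (E E' : List (ℕ × ℕ)) :
    (eqToks (E ++ E') : List (Tok T)) = eqToks E ++ eqToks E' := List.flatMap_append

theorem exists_run_expandConstraint :
    ∃ c, ∀ (B n : ℕ) (l : List ℕ) (rest o s e : List (Sym T)), l.length = k → (∀ i ∈ l, i ≤ B) →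
      n ≤ B → isTick rest.head? = false →
      Run (expandConstraint encR A) (regs (encToks (l.map .name) ++ rest) o s e [] (ticks n) [] [])
        (regs rest ((encToks ((A.preds n).flatMap (RawConstraint.toks encR))).reverse ++ o)
          ((A.sorts.map .sort).reverse ++ s)
          ((encToks (eqToks (A.eqs n ++ scopeEqs (n + A.bound) l))).reverse ++ e)
          [] (ticks (n + A.size)) [] []) (c * (B + 1)) := by
  obtain ⟨c₁, h₁⟩ := exists_run_emitToks (k := Reg.out) (by decide) (by decide)
    ((A.preds 0).flatMap (RawConstraint.toks encR))
  obtain ⟨c₂, h₂⟩ := exists_run_emitToks (k := Reg.eqs) (by decide) (by decide)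
    (eqToks (A.eqs 0) : List (Tok T))
  obtain ⟨c₃, h₃⟩ := exists_run_emitScope (T := T) A.bound k
  refine ⟨c₁ + c₂ + c₃ + (2 * A.size + 2), fun B n l rest o s e hl hB hn hr => ?_⟩
  have e₁ := h₁ n (regs (encToks (l.map .name) ++ rest) o s e [] (ticks n) [] []) rfl rfl
  rw [← flatMap_toks_map_rename, ← A.preds_eq_map, update_regs_out, regs_out] at e₁
  have e₂ := h₂ n (regs (encToks (l.map .name) ++ rest)
    ((encToks ((A.preds n).flatMap (RawConstraint.toks encR))).reverse ++ o) s e [] (ticks n) [] [])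
    rfl rfl
  rw [← eqToks_map, ← A.eqs_eq_map, update_regs_eqs, regs_eqs] at e₂
  refine (Run.seq e₁ (Run.seq e₂ (Run.seq (h₃ B n l rest _ s _ hl hB hn hr)
    (Run.seq (run_pushList _ _ _) (run_pushList _ _ _))))).cast ?_ ?_
  · simp [eqToks_append, ticks, Nat.add_comm n]
  · simp only [List.length_map, A.length_sorts, List.length_replicate]
    nlinarith [Nat.mul_le_mul_left c₁ hn, Nat.mul_le_mul_left c₂ hn]

end

variable (L : ∀ R : Relation D, PPFormula Γ R.arity)

/-- Read an input word: the sorts of the variables are counted and moved to `sorts`, the constraints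
are expanded, and everything else is moved to `out`. The number `d` bounds the length of the codes
of the relations. -/
def expandAll (d : ℕ) : StackProg Reg (Sym T) :=
  loop .main Option.isSome fun
    | some (.sort t) => seq (push .sorts (.sort t)) (push .j .tick)
    | some .constraint =>
      readBits (fun w => (encR.decode w).elim skip fun R => expandConstraint encR (L R)) d []
    | some a => push .out a
    | none => skip

/-- The constant `c` bounds the cost of expanding a constraint with the relation `R`, and the size
of the outcome. -/
structure ExpansionBound (R : Relation D) (c : ℕ) : Prop where
  code : (encR.encode R).length ≤ c
  size : (L R).size ≤ c
  preds : (((L R).preds 0).flatMap (RawConstraint.toks encR)).length ≤ c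
  eqs : ((L R).eqs 0).length + R.arity ≤ c
  run : ∀ (B n : ℕ) (l : List ℕ) (rest o s e : List (Sym T)), l.length = R.arity →
    (∀ i ∈ l, i ≤ B) → n ≤ B → isTick rest.head? = false →
    Run (expandConstraint encR (L R))
      (regs (encToks (l.map .name) ++ rest) o s e [] (ticks n) [] [])
      (regs rest ((encToks (((L R).preds n).flatMap (RawConstraint.toks encR))).reverse ++ o)
        (((L R).sorts.map .sort).reverse ++ s)
        ((encToks (eqToks ((L R).eqs n ++ scopeEqs (n + (L R).bound) l))).reverse ++ e)
        [] (ticks (n + (L R).size)) [] []) (c * (B + 1))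

variable {encR L}

theorem run_expandAll_sorts {d : ℕ} (l : List T) {n t : ℕ} {rest s : List (Sym T)}
    {S' : Reg → List (Sym T)}
    (h : Run (expandAll encR L d)
      (regs rest [] ((l.map .sort).reverse ++ s) [] [] (ticks (n + l.length)) [] []) S' t) :
    Run (expandAll encR L d) (regs (l.map .sort ++ rest) [] s [] [] (ticks n) [] []) S'
      (t + 3 * l.length) := by
  induction l generalizing n s with
  | nil => exact h
  | cons a l ih =>
    refine (Run.next rfl (Run.seq (Run.push _ _ _) (Run.push _ _ _))
      (t' := t + 3 * l.length) ?_).mono (by simp; omega)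
    have := ih (n := n + 1) (s := .sort a :: s) (by
      rw [Nat.add_assoc, Nat.add_comm 1]
      simpa using h)
    change Run (expandAll encR L d) _ _ _
    simpa [ticks, List.replicate_succ] using this

theorem run_expandAll_terms {d : ℕ} (w : List (Tok T))
    (hw : ∀ a ∈ w, a ≠ .constraint ∧ ∀ t, a ≠ .sort t) (o s e j : List (Sym T)) :
    Run (expandAll encR L d) (regs (encToks w) o s e [] j [] [])
      (regs [] ((encToks w).reverse ++ o) s e [] j [] []) (2 * (encToks w).length + 2) := by
  have hw' : ∀ a ∈ encToks w, a ≠ .constraint ∧ ∀ t, a ≠ .sort t := by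
    intro a ha
    obtain ⟨b, hb, hab⟩ := List.mem_flatMap.1 ha
    obtain ⟨h1, h2⟩ := hw b hb
    cases b with
    | sort t => exact absurd rfl (h2 t)
    | constraint => exact absurd rfl h1
    | name m =>
      rcases List.mem_cons.1 hab with rfl | h
      · exact ⟨nofun, nofun⟩
      · exact (List.eq_of_mem_replicate h) ▸ ⟨nofun, nofun⟩
    | _ => exact (List.mem_singleton.1 hab) ▸ ⟨nofun, nofun⟩
  generalize encToks w = u at hw'
  induction u generalizing o with
  | nil => exact (Run.last rfl (Run.skip _)).cast (by simp) (by simp)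
  | cons a u ih =>
    rw [List.forall_mem_cons] at hw'
    have h1 := ih (a :: o) hw'.2
    refine (Run.next (t := 1) (S' := regs u (a :: o) s e [] j [] []) rfl ?_ h1).cast
      (by simp) (by simp; omega)
    have h2 : Run (push .out a) (regs u o s e [] j [] []) (regs u (a :: o) s e [] j [] []) 1 := by
      simpa using Run.push Reg.out a (regs u o s e [] j [] [])
    cases a <;> simp_all

theorem run_expandAll_constraints {c : ℕ} (hc : ∀ R ∈ Δ, ExpansionBound encR L R c)
    {B : ℕ} (cs : List (RawConstraint D)) (hcs : ∀ a ∈ cs, a.rel ∈ Δ ∧ ∀ j, a.scope j ≤ B) {n : ℕ}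
    (hn : n + (newSorts L cs).length ≤ B) {rest o s e : List (Sym T)}
    (hr : isTick rest.head? = false) (hr' : isBit rest.head? = false)
    {S' : Reg → List (Sym T)} {t : ℕ}
    (h : Run (expandAll encR L c)
      (regs rest ((encToks ((newPreds L n cs).flatMap (RawConstraint.toks encR))).reverse ++ o)
        (((newSorts L cs).map .sort).reverse ++ s)
        ((encToks (eqToks (newEqs L n cs))).reverse ++ e)
        [] (ticks (n + (newSorts L cs).length)) [] []) S' t) :
    Run (expandAll encR L c)
      (regs (encToks (cs.flatMap (RawConstraint.toks encR)) ++ rest) o s e [] (ticks n) [] []) S'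
      (t + cs.length * (c * (B + 1) + c + 3)) := by
  induction cs generalizing n o s e with
  | nil => simpa [newPreds, newSorts, newEqs, eqToks] using h
  | cons a cs ih =>
    rw [List.forall_mem_cons] at hcs
    rw [newSorts_cons, List.length_append, (L a.rel).length_sorts] at hn
    have hrec := ih hcs.2 (n := n + (L a.rel).size)
      (o := (encToks (((L a.rel).preds n).flatMap (RawConstraint.toks encR))).reverse ++ o)
      (s := ((L a.rel).sorts.map .sort).reverse ++ s)
      (e := (encToks (eqToks ((L a.rel).eqs n ++
        scopeEqs (n + (L a.rel).bound) (List.ofFn a.scope)))).reverse ++ e)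
      (by omega)
      (by
        simp only [newPreds, newEqs, newSorts_cons, List.flatMap_append, encToks_append,
          List.reverse_append, List.append_assoc, List.map_append, List.length_append,
          (L a.rel).length_sorts, eqToks_append] at h ⊢
        simpa only [Nat.add_assoc] using h)
    set rest' := encToks (cs.flatMap (RawConstraint.toks encR)) ++ rest with hrest
    have hr1 : isTick rest'.head? = false := by
      rcases cs with _ | ⟨b, cs⟩
      · simpa [hrest] using hr
      · rfl
    have hr2 : isBit (encToks ((List.ofFn a.scope).map .name) ++ rest').head? = false := by
      rcases List.ofFn a.scope with _ | ⟨x, l⟩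
      · rcases cs with _ | ⟨b, cs⟩
        · simpa [hrest] using hr'
        · rfl
      · rfl
    have h1 := (hc _ hcs.1.1).run B n (List.ofFn a.scope) rest' o s e (by simp)
      (by simpa using hcs.1.2) (by omega) hr1
    have h2 := run_readBits (d := c) (bits := encR.encode a.rel) (w := [])
      (body := fun w => (encR.decode w).elim skip fun R => expandConstraint encR (L R))
      (hc _ hcs.1.1).code hr2 (by simpa using h1)
    have hmain : encToks ((a :: cs).flatMap (RawConstraint.toks encR)) ++ rest =
        .constraint :: ((encR.encode a.rel).map .bit ++
          (encToks ((List.ofFn a.scope).map .name) ++ rest')) := by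
      rw [List.flatMap_cons, encToks_append, a.encToks_toks]
      simp [hrest]
    rw [hmain]
    refine (Run.next rfl (by simpa using h2) hrec).mono ?_
    have := (hc _ hcs.1.1).code
    rw [List.length_cons]
    nlinarith

end Expansion

end MultiSorted

namespace MultiSorted

open StackProg

/-! ### Running time and conclusion -/

section Reduction

variable {T F K : Type} {D : T → Finset F} {Γ Δ : Set (Relation D)}
  (encR : Computability.Encoding (Relation D) Bool) (encK : Computability.Encoding K Bool)
  (L : ∀ R : Relation D, PPFormula Γ R.arity)

instance [Finite T] : Finite (Sym T) :=
  Finite.of_injective (β := T ⊕ Bool ⊕ Fin 4)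
    (fun
      | .sort t => .inl t
      | .bit b => .inr (.inl b)
      | .constraint => .inr (.inr 0)
      | .term => .inr (.inr 1)
      | .var => .inr (.inr 2)
      | .tick => .inr (.inr 3))
    (by intro a b h; cases a <;> cases b <;> simp_all)

/-- The program for the reduction. After the expansion, the stack `main` is refilled with the
equations, followed by the expanded constraints and the polynomial. -/
def reduceProg (d : ℕ) : StackProg Reg (Sym T) :=
  seq (expandAll encR L d) (seq (move .out .main) (seq (move .eqs .main) (seq (clear .j)
    (seq mergeAll (move .sorts .main)))))

theorem length_scopeEqs (m : ℕ) (l : List ℕ) : (scopeEqs m l).length = l.length := by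
  induction l generalizing m <;> simp_all [scopeEqs]

variable {encR L}

theorem ExpansionBound.mono {R : Relation D} {c c' : ℕ} (h : ExpansionBound encR L R c)
    (hc : c ≤ c') : ExpansionBound encR L R c' where
  code := h.code.trans hc
  size := h.size.trans hc
  preds := h.preds.trans hc
  eqs := h.eqs.trans hc
  run B n l rest o s e h1 h2 h3 h4 :=
    (h.run B n l rest o s e h1 h2 h3 h4).mono (Nat.mul_le_mul_right _ hc)

variable (encR L)

theorem exists_expansionBound (R : Relation D) : ∃ c, ExpansionBound encR L R c := by
  obtain ⟨c, hc⟩ := exists_run_expandConstraint encR (L R)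
  refine ⟨c + (encR.encode R).length + (L R).size +
    (((L R).preds 0).flatMap (RawConstraint.toks encR)).length +
    (((L R).eqs 0).length + R.arity), by omega, by omega, by omega, by omega, ?_⟩
  intro B n l rest o s e h1 h2 h3 h4
  exact (hc B n l rest o s e h1 h2 h3 h4).mono (Nat.mul_le_mul_right _ (by omega))

theorem exists_forall_expansionBound (hΔ : Δ.Finite) :
    ∃ c, ∀ R ∈ Δ, ExpansionBound encR L R c := by
  choose c hc using exists_expansionBound encR L
  obtain ⟨b, hb⟩ := (hΔ.image c).bddAbove
  exact ⟨b, fun R hR => (hc R).mono (hb (Set.mem_image_of_mem c hR))⟩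

variable {encR L}

section Length

variable {c : ℕ} {cs : List (RawConstraint D)}

theorem length_newSorts_le (h : ∀ a ∈ cs, ExpansionBound encR L a.rel c) :
    (newSorts L cs).length ≤ cs.length * c := by
  induction cs with
  | nil => simp [newSorts]
  | cons a cs ih =>
    rw [List.forall_mem_cons] at h
    rw [newSorts_cons, List.length_append, (L a.rel).length_sorts, List.length_cons, Nat.add_mul,
      Nat.one_mul]
    have := ih h.2
    have := h.1.size
    omega

theorem length_toks_newPreds_le (h : ∀ a ∈ cs, ExpansionBound encR L a.rel c) (n : ℕ) :
    ((newPreds L n cs).flatMap (RawConstraint.toks encR)).length ≤ cs.length * c := by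
  induction cs generalizing n with
  | nil => simp [newPreds]
  | cons a cs ih =>
    rw [List.forall_mem_cons] at h
    rw [newPreds, List.flatMap_append, List.length_append, (L a.rel).preds_eq_map,
      flatMap_toks_map_rename, List.length_map, List.length_cons, Nat.add_mul, Nat.one_mul]
    have := ih h.2 (n + (L a.rel).size)
    have := h.1.preds
    omega

theorem length_newEqs_le (h : ∀ a ∈ cs, ExpansionBound encR L a.rel c) (n : ℕ) :
    (newEqs L n cs).length ≤ cs.length * c := by
  induction cs generalizing n with
  | nil => simp [newEqs]
  | cons a cs ih =>
    rw [List.forall_mem_cons] at h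
    rw [newEqs, List.length_append, List.length_append, (L a.rel).eqs_eq_map, List.length_map,
      length_scopeEqs, List.length_ofFn, List.length_cons, Nat.add_mul, Nat.one_mul]
    have := ih h.2 (n + (L a.rel).size)
    have := h.1.eqs
    omega

end Length

theorem time_le {c l n k u N W E : ℕ} (hl : n + k + u ≤ l) (hN : N ≤ n + k * c)
    (hW : W ≤ k * c + u) (hE : E ≤ k * c) :
    (2 * u + 2 + k * (c * (N + 1) + c + 3) + 3 * n) + ((2 * (W * (N + 1)) + 2) +
      ((2 * (2 * E * (N + 1)) + 2) + ((2 * N + 2) +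
        ((E * ((2 * E + W + 1) * (16 * N + 40)) + 2) + (2 * N + 2))))) ≤
      300 * ((c + 1) * (l + 1)) ^ 3 := by
  have hx : n + k + u + k * c + c + 1 ≤ (c + 1) * (l + 1) := by nlinarith
  generalize (c + 1) * (l + 1) = x at hx
  have hNx : N ≤ x := by omega
  have hWx : W ≤ x := by omega
  have hEx : E ≤ x := by omega
  have hk : k * (c * (N + 1) + c + 3) ≤ x * (x + 1) + 4 * x := by
    have : k * c * (N + 1) ≤ x * (x + 1) := Nat.mul_le_mul (by omega) (by omega)
    calc k * (c * (N + 1) + c + 3) = k * c * (N + 1) + k * c + 3 * k := by ring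
      _ ≤ _ := by omega
  have h1 : W * (N + 1) ≤ x * (x + 1) := Nat.mul_le_mul hWx (by omega)
  have h2 : 2 * E * (N + 1) ≤ 2 * x * (x + 1) := Nat.mul_le_mul (by omega) (by omega)
  have h3 : E * ((2 * E + W + 1) * (16 * N + 40)) ≤ x * ((3 * x + 1) * (16 * x + 40)) :=
    Nat.mul_le_mul hEx (Nat.mul_le_mul (by omega) (by omega))
  obtain ⟨y, rfl⟩ : ∃ y, x = y + 1 := ⟨x - 1, by omega⟩
  calc _ ≤ (2 * (y + 1) + 2 + ((y + 1) * (y + 1 + 1) + 4 * (y + 1)) + 3 * (y + 1)) +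
      ((2 * ((y + 1) * (y + 1 + 1)) + 2) + ((2 * (2 * (y + 1) * (y + 1 + 1)) + 2) +
        ((2 * (y + 1) + 2) + (((y + 1) * ((3 * (y + 1) + 1) * (16 * (y + 1) + 40)) + 2) +
          (2 * (y + 1) + 2))))) := by omega
    _ ≤ 300 * (y + 1) ^ 3 := by
      have e1 := Nat.zero_le (y ^ 2)
      have e2 := Nat.zero_le (y ^ 3)
      nlinarith

theorem head?_toks_ne_name (cs : List (RawConstraint D)) {n : ℕ} (p : PolyExpr K n) (i : ℕ) :
    (cs.flatMap (RawConstraint.toks encR) ++ p.flatMap (termToks encK)).head? ≠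
      some (.name i) := by
  rcases cs with _ | ⟨a, cs⟩
  · rcases p with _ | ⟨t, p⟩ <;> simp [termToks]
  · simp [RawConstraint.toks]

theorem run_reduceProg {c : ℕ} (hc : ∀ R ∈ Δ, ExpansionBound encR L R c)
    (hL : ∀ R ∈ Δ, ∀ j, (L R).sort (.inr j) = R.sig j) (I : IMPInput Δ K) :
    Run (reduceProg encR L c) (single .main (I.encode encR encK))
      (single .main ((I.reduce hL).encode encR encK))
      (300 * ((c + 1) * ((I.encode encR encK).length + 1)) ^ 3) := by
  set cs := I.inst.raws with hcs
  set w : List (Tok T) := I.poly.flatMap (termToks encK) with hw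
  set W := (newPreds L I.inst.n cs).flatMap (RawConstraint.toks encR) ++ w with hWdef
  set E := newEqs L I.inst.n cs with hE
  set N := (I.inst.allSorts L).length with hN
  have hNeq : I.inst.n + (newSorts L cs).length = N := by
    simp [hN, MCSP.allSorts, hcs]
  have hbd : ∀ a ∈ cs, ExpansionBound encR L a.rel c := fun a ha =>
    hc _ (I.inst.raws_valid a ha).1
  have hwN : NamesLE N w := by
    intro i hi
    obtain ⟨t, -, ht⟩ := List.mem_flatMap.1 hi
    simp only [termToks, List.mem_cons, reduceCtorEq, List.mem_append, List.mem_map, and_false,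
      exists_false, false_or, List.mem_flatMap, Tok.name.injEq, or_false] at ht
    obtain ⟨q, -, rfl⟩ := ht
    have := q.1.2
    omega
  have hWN : NamesLE N W := by
    refine NamesLE.append (fun i hi => ?_) hwN
    obtain ⟨a, ha, hi⟩ := List.mem_flatMap.1 hi
    simp only [RawConstraint.toks, List.mem_cons, reduceCtorEq, List.mem_append, List.mem_map,
      and_false, exists_false, false_or, Tok.name.injEq, exists_eq_right, List.mem_ofFn] at hi
    obtain ⟨j, rfl⟩ := hi
    exact ((MCSP.valid_of_mem ha).lt j).le
  have hEN : NamesLE N (eqToks E : List (Tok T)) := by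
    intro i hi
    obtain ⟨p, hp, hi⟩ := List.mem_flatMap.1 hi
    obtain ⟨t, h1, h2⟩ := MCSP.exists_sort_of_mem hL hp
    have h1 := (List.getElem?_eq_some_iff.1 h1).1
    have h2 := (List.getElem?_eq_some_iff.1 h2).1
    simp only [pairToks, List.mem_cons, Tok.name.injEq, List.not_mem_nil, or_false] at hi
    omega
  have hwhead : isTick (encToks w).head? = false ∧ isBit (encToks w).head? = false := by
    refine ⟨isTick_head?_encToks w, ?_⟩
    rw [hw]
    rcases I.poly with _ | ⟨t, p⟩ <;> rfl
  have hexp : Run (expandAll encR L c) (single .main (I.encode encR encK))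
      (regs [] (encToks W).reverse ((I.inst.allSorts L).map .sort).reverse
        (encToks (eqToks E)).reverse [] (ticks N) [] [])
      (2 * (encToks w).length + 2 + cs.length * (c * (N + 1) + c + 3) + 3 * I.inst.n) := by
    have h1 := run_expandAll_terms (encR := encR) (L := L) (d := c) w
      (by
        intro a ha
        obtain ⟨t, -, ht⟩ := List.mem_flatMap.1 ha
        simp only [termToks, List.mem_cons, List.mem_append, List.mem_map, List.mem_flatMap] at ht
        rcases ht with rfl | ⟨b, -, rfl⟩ | ⟨q, -, rfl | ⟨b, -, rfl⟩⟩ <;> exact ⟨nofun, nofun⟩)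
      ((encToks ((newPreds L I.inst.n cs).flatMap (RawConstraint.toks encR))).reverse ++ [])
      (((newSorts L cs).map .sort).reverse ++ ((List.ofFn I.inst.δ).map .sort).reverse)
      ((encToks (eqToks E)).reverse ++ []) (ticks (I.inst.n + (newSorts L cs).length))
    have h2 := run_expandAll_constraints hc (B := N) cs
      (fun a ha => ⟨(I.inst.raws_valid a ha).1, fun j => by
        have := (I.inst.raws_valid a ha).lt j
        rw [List.length_ofFn] at this
        omega⟩) hNeq.le hwhead.1 hwhead.2 h1
    have h3 := run_expandAll_sorts (List.ofFn I.inst.δ) (n := 0) (s := [])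
      (by simpa using h2)
    rw [IMPInput.encode_eq, single_main]
    refine h3.cast ?_ (by rw [List.length_ofFn])
    rw [hNeq]
    simp [hWdef, MCSP.allSorts, hcs]
  have hmerge := run_mergeAll E W (head?_toks_ne_name encK _ _) (hEN.append hWN)
    ((I.inst.allSorts L).map .sort).reverse
  refine (Run.seq hexp (Run.seq (run_move (by decide) _) (Run.seq (run_move (by decide) _)
    (Run.seq (run_clear _ _) (Run.seq (S' := regs (encToks (W.map (Tok.map (merge E)))) []
      ((I.inst.allSorts L).map .sort).reverse [] [] [] [] [])
      (t := E.length * ((2 * E.length + W.length + 1) * (16 * N + 40)) + 2) ?_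
      (run_move (by decide) _)))))).cast ?_ ?_
  · simpa using hmerge
  · rw [IMPInput.encode_reduce encR encK hL, single_main]
    simp [hWdef, hw, hcs, hE, MCSP.merging]
  · have hlenW := hWN.length_encToks_le
    have hlenE := hEN.length_encToks_le
    rw [length_eqToks] at hlenE
    have hcslen : cs.length ≤ (encToks (cs.flatMap (RawConstraint.toks encR))).length := by
      refine le_trans ?_ (length_le_length_encToks _)
      clear_value cs
      clear * -
      induction cs with
      | nil => simp
      | cons a cs ih =>
        rw [List.flatMap_cons, List.length_append, List.length_cons]
        have : 1 ≤ (a.toks encR).length := by simp [RawConstraint.toks]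
        omega
    have hlen : (I.encode encR encK).length = I.inst.n +
        ((encToks (cs.flatMap (RawConstraint.toks encR))).length + (encToks w).length) := by
      rw [IMPInput.encode_eq]
      simp [hcs, hw]
    have hNle := length_newSorts_le hbd
    have hWle := length_toks_newPreds_le hbd I.inst.n
    have hEle := length_newEqs_le hbd I.inst.n
    have hwle := length_le_length_encToks w
    have hWlen : W.length ≤ cs.length * c + (encToks w).length := by
      rw [hWdef, List.length_append]
      omega
    refine le_trans ?_ (time_le (c := c) (l := (I.encode encR encK).length) (n := I.inst.n)
      (k := cs.length) (u := (encToks w).length) (N := N) (W := W.length) (E := E.length)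
      (by omega) (by omega) hWlen hEle)
    simp only [regs_out, regs_eqs, regs_j, regs_sorts, List.length_reverse, update_regs_main,
      update_regs_out, update_regs_eqs, List.length_replicate, List.length_map]
    omega

end Reduction

end MultiSorted

theorem mainTheorem6 {T F K : Type} [Finite T] [Field F] (D : T → Finset F)
    (encR : Computability.Encoding (MultiSorted.Relation D) Bool)
    (encK : Computability.Encoding K Bool) (val : K → F)
    (Γ Δ : Set (MultiSorted.Relation D)) (hΔ : Δ.Finite) (hpp : MultiSorted.PPDefines Γ Δ) :
    (MultiSorted.IMP encR encK val Δ).PolyTimeReducible (MultiSorted.IMP encR encK val Γ) ∧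
    ∀ d : ℕ, (MultiSorted.IMPd encR encK val d Δ).PolyTimeReducible
      (MultiSorted.IMPd encR encK val d Γ) := by
  classical
  have hex : ∀ R : MultiSorted.Relation D, ∃ A : MultiSorted.PPFormula Γ R.arity, R ∈ Δ →
      (∀ j, A.sort (.inr j) = R.sig j) ∧ ∀ v, v ∈ R.tuples ↔ A.Holds v := by
    intro R
    by_cases hR : R ∈ Δ
    · obtain ⟨A, hA⟩ := hpp R hR
      exact ⟨A, fun _ => hA⟩
    · exact ⟨⟨0, Sum.elim Fin.elim0 R.sig, []⟩, fun h => absurd h hR⟩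
  choose L hL using hex
  obtain ⟨c, hc⟩ := MultiSorted.exists_forall_expansionBound encR L hΔ
  have hsort : ∀ R ∈ Δ, ∀ j, (L R).sort (.inr j) = R.sig j := fun R hR => (hL R hR).1
  have hdef : ∀ R ∈ Δ, ∀ v, v ∈ R.tuples ↔ (L R).Holds v := fun R hR => (hL R hR).2
  let time : Polynomial ℕ := 300 * (Polynomial.C (c + 1) * (Polynomial.X + 1)) ^ 3
  have htime : ∀ l : ℕ, time.eval l = 300 * ((c + 1) * (l + 1)) ^ 3 := fun l => by
    simp [time, Polynomial.eval_mul, Polynomial.eval_pow, Polynomial.eval_add]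
  refine ⟨⟨fun I => I.reduce hsort, ?_, fun I => I.reduce_mem_ideal_iff val hsort hdef⟩,
    fun d => ⟨fun I => ⟨I.1.reduce hsort, (I.1.totalDegree_reduce_le val hsort).trans I.2⟩, ?_,
      fun I => I.1.reduce_mem_ideal_iff val hsort hdef⟩⟩
  · refine StackProg.nonempty_tm2ComputableInPolyTime (A := MultiSorted.Sym T) _ _ _
      (MultiSorted.reduceProg encR L c) .main time fun I => ?_
    rw [htime]
    exact MultiSorted.run_reduceProg encK hc hsort I
  · refine StackProg.nonempty_tm2ComputableInPolyTime (A := MultiSorted.Sym T) _ _ _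
      (MultiSorted.reduceProg encR L c) .main time fun I => ?_
    rw [htime]
    exact MultiSorted.run_reduceProg encK hc hsort I.1
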